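/- Let $M$ be a (Hausdorff, finite-dimensional, boundaryless) smooth manifold and $p\in M$. For $k\ge 0$ and $r\in\{0,1,\dots,\infty\}$ let $\mathcal E^k_r(M)$ be the space of $C^r$ differential $k$-forms on $M$ with its usual topology (uniform convergence, on compact subsets of charts, of the coefficients and of their derivatives of all finite orders $\le r$), and put $\mathcal E^k(M)=\mathcal E^k_\infty(M)$. Let $\mathcal U_k(M;p)$ be the space of de Rham currents of dimension $k$ supported at $p$, that is, of the continuous linear functionals $T$ on $\mathcal E^k(M)$ with $T(\omega)=0$ whenever $\omega$ vanishes in a neighbourhood of $p$. Let $\mathcal U_k^r(M;p)\subseteq\mathcal U_k(M;p)$, $r\in\mathbb N$, be the subspace of currents of order at most $r$, that is, of those which extend to a continuous linear functional on $\mathcal E^k_r(M)$. The fiber of $\mathcal U(M)$ at $p$ is $\mathcal U(M;p)=\bigoplus_{k\ge 0}\mathcal U_k(M;p)$. A form $\omega\in\mathcal E^k(M)$ is evaluated on $T\in\mathcal U(M;p)$ by $\omega(T)=T_k(\omega)$, with $T_k$ the component of $T$ of dimension $k$, and $(\omega\otimes\eta)(S\otimes T)=\omega(S)\,\eta(T)$.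 Then $\mathcal U(M;p)$ is a filtered differential graded co-algebra: there are linear maps $\Delta:\mathcal U(M;p)\to\mathcal U(M;p)\otimes\mathcal U(M;p)$, $\epsilon:\mathcal U(M;p)\to\mathbb R$ and $\partial:\mathcal U_{k+1}(M;p)\to\mathcal U_k(M;p)$ for $k\ge 0$ (with $\partial=0$ on $\mathcal U_0(M;p)$) such that 1. $\Delta$ is co-associative with co-unit $\epsilon$, and $\epsilon$ vanishes on $\mathcal U_k(M;p)$ for $k\geq 1$; 2. $\mathcal U_k^0(M;p)\subseteq\mathcal U_k^1(M;p)\subseteq\cdots$ with $\bigcup_r\mathcal U_k^r(M;p)=\mathcal U_k(M;p)$ for every $k$; moreover $\Delta(\mathcal U_l^r(M;p))\subseteq\sum_{a+b=l}\sum_{s+t=r}\mathcal U_a^s(M;p)\otimes\mathcal U_b^t(M;p)$ and $\partial(\mathcal U_{k+1}^r(M;p))\subseteq\mathcal U_k^{r+1}(M;p)$; 3. $\partial\circ\partial=0$, $\epsilon\circ\partial=0$, and $\partial$ is a co-derivation: $\Delta\circ\partial=(\partial\otimes\mathrm{id}+\sigma\otimes\partial)\circ\Delta$, where $\sigma=(-1)^k$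 on $\mathcal U_k(M;p)$; 4. the co-product is dual to the wedge product, $(\omega\otimes\eta)(\Delta T)=(\omega\wedge\eta)(T)$ for all $\omega\in\mathcal E^a(M)$, $\eta\in\mathcal E^b(M)$, $T\in\mathcal U(M;p)$; the co-unit is $\epsilon(T)=1(T)$, where $1\in\mathcal E^0(M)$ is the constant function; and the differential is dual to the exterior derivative, $(\partial T)(\omega)=T(d\omega)$ for all $T\in\mathcal U_{k+1}(M;p)$ and $\omega\in\mathcal E^k(M)$. -/

import Mathlib

open scoped Manifold ContDiff Topology TensorProduct DirectSum

noncomputable section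

/-! ### Filtered differential graded coalgebras -/

section Coalgebra

universe u

variable {U : ℕ → Type u} [∀ k, AddCommGroup (U k)] [∀ k, Module ℝ (U k)]

/-- The degree `-1` endomorphism of `⨁ k, U k` assembled from maps `U (k + 1) → U k`
(it vanishes on `U 0`). -/
def totalBoundary (bd : ∀ k, U (k + 1) →ₗ[ℝ] U k) : (⨁ k, U k) →ₗ[ℝ] ⨁ k, U k :=
  DirectSum.toModule ℝ ℕ _ fun k =>
    match k with
    | 0 => 0
    | k + 1 => DirectSum.lof ℝ ℕ U k ∘ₗ bd k

variable (U) in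
/-- The sign operator, multiplication by `(-1) ^ k` on `U k`. -/
def gradingSign : (⨁ k, U k) →ₗ[ℝ] ⨁ k, U k :=
  DirectSum.toModule ℝ ℕ _ fun k => (-1 : ℝ) ^ k • DirectSum.lof ℝ ℕ U k

/-- The part of total degree `l` and total filtration `≤ r` of `(⨁ k, U k) ⊗ (⨁ k, U k)`, that is
`∑_{a + b = l} ∑_{s + t = r} F a s ⊗ F b t`. -/
def tensorFiltration (F : ∀ k, ℕ → Submodule ℝ (U k)) (l r : ℕ) :
    Submodule ℝ ((⨁ k, U k) ⊗[ℝ] (⨁ k, U k)) :=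
  ⨆ ab ∈ Finset.HasAntidiagonal.antidiagonal l, ⨆ st ∈ Finset.HasAntidiagonal.antidiagonal r,
    LinearMap.range (TensorProduct.map
      (DirectSum.lof ℝ ℕ U ab.1 ∘ₗ (F ab.1 st.1).subtype)
      (DirectSum.lof ℝ ℕ U ab.2 ∘ₗ (F ab.2 st.2).subtype))

/-- A filtered differential graded coalgebra structure on the graded real vector space
`⨁ k, U k`, whose degree `k` part is filtered by the subspaces `F k 0, F k 1, …`.
The coalgebra is coassociative and counital (by `Coalgebra`), all structure maps respect the
grading, the differential has degree `-1`, is a coderivation (with the Koszul sign) and may raise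
the filtration by one, as the transpose of a first order differential operator does. -/
structure FilteredDGCoalgebra (U : ℕ → Type u) [∀ k, AddCommGroup (U k)] [∀ k, Module ℝ (U k)]
    (F : ∀ k, ℕ → Submodule ℝ (U k)) extends Coalgebra ℝ (⨁ k, U k) where
  /-- the differential -/
  boundary : ∀ k, U (k + 1) →ₗ[ℝ] U k
  filtration_mono : ∀ k, Monotone (F k)
  filtration_exhaustive : ∀ k, ∀ x : U k, ∃ r, x ∈ F k r
  comul_mem : ∀ l r, ∀ x ∈ F l r, comul (DirectSum.lof ℝ ℕ U l x) ∈ tensorFiltration F l r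
  counit_lof_succ : ∀ k, ∀ x : U (k + 1), counit (DirectSum.lof ℝ ℕ U (k + 1) x) = 0
  boundary_mem : ∀ k r, ∀ x ∈ F (k + 1) r, boundary k x ∈ F k (r + 1)
  boundary_boundary : ∀ k, ∀ x : U (k + 2), boundary k (boundary (k + 1) x) = 0
  counit_boundary : ∀ x : U 1, counit (DirectSum.lof ℝ ℕ U 0 (boundary 0 x)) = 0
  comul_boundary : comul ∘ₗ totalBoundary boundary =
    (TensorProduct.map (totalBoundary boundary) LinearMap.id +
      TensorProduct.map (gradingSign U) (totalBoundary boundary)) ∘ₗ comul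

end Coalgebra

/-! ### Wedge product of alternating forms -/

section Wedge

variable {V : Type*} [AddCommGroup V] [Module ℝ V] [TopologicalSpace V]

lemma mul_domCoprod_summand {a b : ℕ} (f : V [⋀^Fin a]→L[ℝ] ℝ) (g : V [⋀^Fin b]→L[ℝ] ℝ)
    (σ : Equiv.Perm (Fin a ⊕ Fin b)) (w : Fin a ⊕ Fin b → V) :
    LinearMap.mul' ℝ ℝ (AlternatingMap.domCoprod.summand f.toAlternatingMap g.toAlternatingMap
      (Quotient.mk'' σ) w) = ((Equiv.Perm.sign σ : ℤ) : ℝ) *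
        (f (fun i => w (σ (Sum.inl i))) * g (fun i => w (σ (Sum.inr i)))) := by
  rw [AlternatingMap.domCoprod.summand_mk'']
  change LinearMap.mul' ℝ ℝ (Equiv.Perm.sign σ •
    ((f fun i => w (σ (Sum.inl i))) ⊗ₜ[ℝ] (g fun i => w (σ (Sum.inr i))))) = _
  rw [Units.smul_def, map_zsmul, zsmul_eq_mul, LinearMap.mul'_apply]

/-- The wedge product of alternating forms on a topological vector space,
`(f ∧ g)(v) = ∑ sign(σ) f(v_σ(1), …, v_σ(a)) g(v_σ(a+1), …, v_σ(a+b))` over `(a, b)`-shuffles. -/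
def altWedge {a b : ℕ} (f : V [⋀^Fin a]→L[ℝ] ℝ) (g : V [⋀^Fin b]→L[ℝ] ℝ) :
    V [⋀^Fin (a + b)]→L[ℝ] ℝ :=
  { ((LinearMap.mul' ℝ ℝ).compAlternatingMap
      (f.toAlternatingMap.domCoprod g.toAlternatingMap)).domDomCongr finSumFinEquiv with
    cont := by
      change Continuous fun v : Fin (a + b) → V => LinearMap.mul' ℝ ℝ
        ((f.toAlternatingMap.domCoprod g.toAlternatingMap) fun i => v (finSumFinEquiv i))
      simp only [AlternatingMap.domCoprod_apply, _root_.sum_apply, map_sum]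
      refine continuous_finsetSum _ fun σ _ => ?_
      induction σ using Quotient.inductionOn' with | _ σ
      simp only [mul_domCoprod_summand]
      refine continuous_const.mul (Continuous.mul ?_ ?_)
      · exact f.cont.comp (continuous_pi fun i => continuous_apply _)
      · exact g.cont.comp (continuous_pi fun i => continuous_apply _) }

lemma altWedge_apply {a b : ℕ} (f : V [⋀^Fin a]→L[ℝ] ℝ) (g : V [⋀^Fin b]→L[ℝ] ℝ)
    (v : Fin (a + b) → V) :
    altWedge f g v = LinearMap.mul' ℝ ℝ
        ((f.toAlternatingMap.domCoprod g.toAlternatingMap) fun i => v (finSumFinEquiv i)) := rfl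

lemma altWedge_eq_sum {a b : ℕ} (f : V [⋀^Fin a]→L[ℝ] ℝ) (g : V [⋀^Fin b]→L[ℝ] ℝ)
    (v : Fin (a + b) → V) :
    altWedge f g v = ∑ σ : Equiv.Perm.ModSumCongr (Fin a) (Fin b), LinearMap.mul' ℝ ℝ
        (AlternatingMap.domCoprod.summand f.toAlternatingMap g.toAlternatingMap σ
          fun i => v (finSumFinEquiv i)) := by
  simp only [altWedge_apply, AlternatingMap.domCoprod_apply, _root_.sum_apply, map_sum]

lemma altWedge_comp {W : Type*} [AddCommGroup W] [Module ℝ W] [TopologicalSpace W] {a b : ℕ}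
    (f : V [⋀^Fin a]→L[ℝ] ℝ) (g : V [⋀^Fin b]→L[ℝ] ℝ) (A : W →L[ℝ] V) :
    (altWedge f g).compContinuousLinearMap A =
      altWedge (f.compContinuousLinearMap A) (g.compContinuousLinearMap A) := by
  ext v
  rw [ContinuousAlternatingMap.compContinuousLinearMap_apply, altWedge_eq_sum, altWedge_eq_sum]
  refine Finset.sum_congr rfl fun σ _ => ?_
  induction σ using Quotient.inductionOn' with | _ σ
  rw [mul_domCoprod_summand, mul_domCoprod_summand]
  rfl

end Wedge

section Smooth

variable {E : Type*} [NormedAddCommGroup E] [NormedSpace ℝ E] [FiniteDimensional ℝ E]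

lemma finiteDimensional_alternating (k : ℕ) : FiniteDimensional ℝ (E [⋀^Fin k]→L[ℝ] ℝ) := by
  let L : (E [⋀^Fin k]→L[ℝ] ℝ) →ₗ[ℝ] MultilinearMap ℝ (fun _ : Fin k => E) ℝ :=
    { toFun := fun f => f.toMultilinearMap
      map_add' := fun _ _ => rfl
      map_smul' := fun _ _ => rfl }
  refine FiniteDimensional.of_injective L fun f g h => ?_
  ext v
  exact congrArg (fun F : MultilinearMap ℝ (fun _ : Fin k => E) ℝ => F v) h

/-- The wedge product as a bilinear map. -/
def altWedgeₗ (E : Type*) [NormedAddCommGroup E] [NormedSpace ℝ E] (a b : ℕ) :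
    (E [⋀^Fin a]→L[ℝ] ℝ) →ₗ[ℝ] (E [⋀^Fin b]→L[ℝ] ℝ) →ₗ[ℝ] (E [⋀^Fin (a + b)]→L[ℝ] ℝ) := by
  refine LinearMap.mk₂ ℝ altWedge ?_ ?_ ?_ ?_ <;> intros <;> ext v <;>
    simp only [ContinuousAlternatingMap.add_apply, ContinuousAlternatingMap.smul_apply,
      altWedge_eq_sum, ← Finset.sum_add_distrib, Finset.smul_sum] <;>
    refine Finset.sum_congr rfl fun σ _ => ?_ <;>
    induction σ using Quotient.inductionOn' <;>
    simp only [mul_domCoprod_summand, ContinuousAlternatingMap.add_apply,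
      ContinuousAlternatingMap.smul_apply, smul_eq_mul] <;> ring

lemma contDiffOn_altWedge {a b : ℕ} {r : WithTop ℕ∞} {s : Set E} {f : E → E [⋀^Fin a]→L[ℝ] ℝ}
    {g : E → E [⋀^Fin b]→L[ℝ] ℝ} (hf : ContDiffOn ℝ r f s) (hg : ContDiffOn ℝ r g s) :
    ContDiffOn ℝ r (fun y => altWedge (f y) (g y)) s := by
  have := finiteDimensional_alternating (E := E) a
  have := finiteDimensional_alternating (E := E) b
  obtain ⟨B, hB⟩ : ∃ B : (E [⋀^Fin a]→L[ℝ] ℝ) →L[ℝ] (E [⋀^Fin b]→L[ℝ] ℝ) →L[ℝ]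
      (E [⋀^Fin (a + b)]→L[ℝ] ℝ), ∀ f g, B f g = altWedge f g :=
    ⟨(altWedgeₗ E a b).toContinuousBilinearMap, fun f g => by
      rw [LinearMap.toContinuousBilinearMap_apply]; rfl⟩
  simp only [← hB]
  exact (B.contDiff.comp_contDiffOn hf).clm_apply hg

end Smooth

/-! ### Differential forms -/

section Forms

variable (E : Type*) [NormedAddCommGroup E] [NormedSpace ℝ E]
  (M : Type*) [TopologicalSpace M] [ChartedSpace E M]

/-- A (not necessarily smooth) differential `k`-form on `M`. -/
abbrev RawForm (k : ℕ) : Type _ := (x : M) → TangentSpace 𝓘(ℝ, E) x [⋀^Fin k]→L[ℝ] ℝ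

variable {E M}

/-- The coordinate expression of a form in the preferred chart `φ` around `x₀`: its pullback by
`φ⁻¹`. It is meaningful on `φ.target`. -/
def formInChart {k : ℕ} (α : RawForm E M k) (x₀ : M) (y : E) : E [⋀^Fin k]→L[ℝ] ℝ :=
  (α ((chartAt E x₀).symm y)).compContinuousLinearMap
    (mfderiv 𝓘(ℝ, E) 𝓘(ℝ, E) (chartAt E x₀).symm y)

variable (E M)

/-- The space of forms of class `C^r`, as a subspace of all forms. -/
def diffFormSubmodule (r : WithTop ℕ∞) (k : ℕ) : Submodule ℝ (RawForm E M k) where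
  carrier := {α | ∀ x₀ : M, ContDiffOn ℝ r (formInChart α x₀) (chartAt E x₀).target}
  add_mem' hα hβ x₀ := (hα x₀).add (hβ x₀)
  zero_mem' _ := contDiffOn_const (c := 0)
  smul_mem' c _ hα x₀ := (hα x₀).const_smul c

/-- The space of `C^r` differential `k`-forms on `M`; for `r = ∞` these are the smooth forms. -/
def DiffForm (r : WithTop ℕ∞) (k : ℕ) : Type _ := diffFormSubmodule E M r k

instance (r : WithTop ℕ∞) (k : ℕ) : AddCommGroup (DiffForm E M r k) :=
  inferInstanceAs (AddCommGroup (diffFormSubmodule E M r k))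

instance (r : WithTop ℕ∞) (k : ℕ) : Module ℝ (DiffForm E M r k) :=
  inferInstanceAs (Module ℝ (diffFormSubmodule E M r k))

/-- The `C^r` topology (for `r = ∞`, the usual Fréchet topology): uniform convergence, on compact
subsets of chart domains, of the coordinate expressions together with their derivatives of every
finite order `j ≤ r`. -/
instance (r : WithTop ℕ∞) (k : ℕ) : TopologicalSpace (DiffForm E M r k) :=
  ⨅ (x₀ : M) (j : ℕ) (_ : (j : WithTop ℕ∞) ≤ r),
    TopologicalSpace.induced
      (fun α : DiffForm E M r k =>
        UniformOnFun.ofFun {K : Set E | IsCompact K ∧ K ⊆ (chartAt E x₀).target}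
          (iteratedFDeriv ℝ j (formInChart α.1 x₀)))
      inferInstance

variable {E M}

/-- The inclusion of smooth forms in `C^r` forms, for finite `r`. -/
def DiffForm.ofSmooth (r : ℕ) {k : ℕ} (α : DiffForm E M ∞ k) : DiffForm E M r k :=
  ⟨α.1, fun x₀ => (α.2 x₀).of_le (by exact_mod_cast le_top)⟩

/-- The constant function `1`, a smooth `0`-form. -/
def DiffForm.one : DiffForm E M ∞ 0 :=
  ⟨fun x => ContinuousAlternatingMap.constOfIsEmpty ℝ (TangentSpace 𝓘(ℝ, E) x) (Fin 0) (1 : ℝ),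
    fun _ => contDiffOn_const
      (c := ContinuousAlternatingMap.constOfIsEmpty ℝ E (Fin 0) (1 : ℝ))⟩

/-- The wedge product of smooth forms. -/
def DiffForm.wedge [FiniteDimensional ℝ E] {a b : ℕ} (α : DiffForm E M ∞ a)
    (β : DiffForm E M ∞ b) : DiffForm E M ∞ (a + b) :=
  ⟨fun x => altWedge (α.1 x) (β.1 x), fun x₀ =>
    (contDiffOn_altWedge (α.2 x₀) (β.2 x₀)).congr fun _ _ => altWedge_comp _ _ _⟩

/-- The exterior derivative of a form, computed at `x` in the preferred chart around `x`. -/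
def extDerivForm {k : ℕ} (α : RawForm E M k) : RawForm E M (k + 1) := fun x =>
  (extDeriv (formInChart α x) (chartAt E x x)).compContinuousLinearMap
    (mfderiv 𝓘(ℝ, E) 𝓘(ℝ, E) (chartAt E x) x)

/-- The exterior derivative is given by the usual formula in every chart. -/
lemma formInChart_extDerivForm [IsManifold 𝓘(ℝ, E) ∞ M] {k : ℕ} (α : DiffForm E M ∞ k) (x₀ : M)
    {y : E} (hy : y ∈ (chartAt E x₀).target) :
    formInChart (extDerivForm α.1) x₀ y = extDeriv (formInChart α.1 x₀) y := by
  set φ := chartAt E x₀ with hφ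
  set x : M := φ.symm y with hx
  set ψ := chartAt E x with hψ
  have hxψ : x ∈ ψ.source := mem_chart_source E x
  let τ : E → E := fun z => ψ (φ.symm z)
  have hne : (∞ : WithTop ℕ∞) ≠ 0 := by simp
  -- near `y`, the inverse chart maps into the domain of `ψ`
  have hφd : ∀ z ∈ φ.target, MDifferentiableAt 𝓘(ℝ, E) 𝓘(ℝ, E) φ.symm z := fun z hz =>
    ((contMDiffOn_chart_symm (I := 𝓘(ℝ, E)) (n := ∞) (x := x₀)).contMDiffAt
      (φ.open_target.mem_nhds hz)).mdifferentiableAt hne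
  have hψc : ∀ q ∈ ψ.source, ContMDiffAt 𝓘(ℝ, E) 𝓘(ℝ, E) ∞ ψ q := fun q hq =>
    (contMDiffOn_chart (I := 𝓘(ℝ, E)) (n := ∞) (x := x)).contMDiffAt (ψ.open_source.mem_nhds hq)
  have hψd : ∀ q ∈ ψ.source, MDifferentiableAt 𝓘(ℝ, E) 𝓘(ℝ, E) ψ q := fun q hq =>
    (hψc q hq).mdifferentiableAt hne
  have hψsd : ∀ z ∈ ψ.target, MDifferentiableAt 𝓘(ℝ, E) 𝓘(ℝ, E) ψ.symm z := fun z hz =>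
    ((contMDiffOn_chart_symm (I := 𝓘(ℝ, E)) (n := ∞) (x := x)).contMDiffAt
      (ψ.open_target.mem_nhds hz)).mdifferentiableAt hne
  have hnear : ∀ᶠ z in 𝓝 y, z ∈ φ.target ∧ φ.symm z ∈ ψ.source :=
    (φ.open_target.mem_nhds hy |> fun h => Filter.Eventually.and h
      ((φ.continuousAt_symm hy).eventually (ψ.open_source.mem_nhds hxψ)))
  have hτd : ∀ z, z ∈ φ.target → φ.symm z ∈ ψ.source →
      fderiv ℝ τ z = (mfderiv 𝓘(ℝ, E) 𝓘(ℝ, E) ψ (φ.symm z)).comp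
        (mfderiv 𝓘(ℝ, E) 𝓘(ℝ, E) φ.symm z) := fun z hz hz' => by
    rw [← mfderiv_eq_fderiv]
    exact mfderiv_comp z (hψd _ hz') (hφd z hz)
  have hτ : ContDiffAt ℝ ∞ τ y := by
    rw [← contMDiffAt_iff_contDiffAt]
    exact (hψc x hxψ).comp y ((contMDiffOn_chart_symm (I := 𝓘(ℝ, E)) (n := ∞)
      (x := x₀)).contMDiffAt (φ.open_target.mem_nhds hy))
  have hpull : (fun z => (formInChart α.1 x (τ z)).compContinuousLinearMap (fderiv ℝ τ z))
      =ᶠ[𝓝 y] formInChart α.1 x₀ := by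
    filter_upwards [hnear] with z hz
    obtain ⟨hz, hz'⟩ := hz
    have hback : ψ.symm (τ z) = φ.symm z := ψ.left_inv hz'
    have hτz : MDifferentiableAt 𝓘(ℝ, E) 𝓘(ℝ, E) τ z := (hψd _ hz').comp z (hφd z hz)
    have hcomp : (ψ.symm ∘ τ) =ᶠ[𝓝 z] φ.symm := by
      filter_upwards [(φ.continuousAt_symm hz).eventually (ψ.open_source.mem_nhds hz')] with w hw
      exact ψ.left_inv hw
    have hchain := mfderiv_comp z (hψsd (τ z) (ψ.map_source hz')) hτz
    rw [hcomp.mfderiv_eq, mfderiv_eq_fderiv] at hchain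
    let G : M → E [⋀^Fin k]→L[ℝ] ℝ := α.1
    have key : ∀ (q q' : M) (_ : q = q') (A B : E →L[ℝ] E) (_ : A = B),
        (G q).compContinuousLinearMap A = (G q').compContinuousLinearMap B := by
      rintro q _ rfl A _ rfl; rfl
    exact key _ _ hback _ _ hchain.symm
  rw [← hpull.extDeriv_eq]
  have hτy : τ y = ψ x := rfl
  rw [extDeriv_pullback (r := ∞) ?_ hτ (by simpa using WithTop.coe_le_coe.2 (le_top : (2 : ℕ∞) ≤ ⊤))]
  · rw [hτd y hy hxψ]
    rfl
  · exact ((α.2 x).contDiffAt (ψ.open_target.mem_nhds (ψ.map_source hxψ))).differentiableAt hne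

/-- The exterior derivative of smooth forms. -/
def DiffForm.d [IsManifold 𝓘(ℝ, E) ∞ M] {k : ℕ} (α : DiffForm E M ∞ k) :
    DiffForm E M ∞ (k + 1) :=
  ⟨extDerivForm α.1, fun x₀ => by
    have h : ContDiffOn ℝ ∞ (fderiv ℝ (formInChart α.1 x₀)) (chartAt E x₀).target :=
      (α.2 x₀).fderiv_of_isOpen (chartAt E x₀).open_target (by simp)
    refine ContDiffOn.congr (f := fun y => ContinuousAlternatingMap.alternatizeUncurryFinCLM ℝ E ℝ
      (fderiv ℝ (formInChart α.1 x₀) y)) ?_ fun y hy => formInChart_extDerivForm α x₀ hy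
    exact (ContinuousLinearMap.contDiff _).comp_contDiffOn h⟩

end Forms

/-! ### Currents supported at a point -/

section Currents

variable (E : Type*) [NormedAddCommGroup E] [NormedSpace ℝ E]
  {M : Type*} [TopologicalSpace M] [ChartedSpace E M]

/-- The degree `k` part of the fibre at `p`: the compactly supported de Rham currents of dimension
`k` (continuous linear functionals on smooth `k`-forms) with support contained in `{p}`. -/
def atomicCurrents (p : M) (k : ℕ) : Submodule ℝ (DiffForm E M ∞ k →L[ℝ] ℝ) where
  carrier := {T | ∀ α : DiffForm E M ∞ k, (∀ᶠ x in 𝓝 p, α.1 x = 0) → T α = 0}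
  add_mem' hT hS α hα := by simp [hT α hα, hS α hα]
  zero_mem' _ _ := rfl
  smul_mem' c _ hT α hα := by simp [hT α hα]

/-- The currents at `p` of dimension `k` and order at most `r`: those that extend to a continuous
linear functional on the space of `C^r` forms. -/
def orderFiltration (p : M) (k r : ℕ) : Submodule ℝ (atomicCurrents E p k) where
  carrier := {T | ∃ S : DiffForm E M r k →L[ℝ] ℝ, ∀ α : DiffForm E M ∞ k,
    S (α.ofSmooth r) = T.1 α}
  add_mem' := by
    rintro _ _ ⟨S, hS⟩ ⟨S', hS'⟩
    exact ⟨S + S', fun α => by simp [hS, hS']⟩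
  zero_mem' := ⟨0, fun _ => rfl⟩
  smul_mem' := by
    rintro c _ ⟨S, hS⟩
    exact ⟨c • S, fun α => by simp [hS]⟩

variable {E}

/-- Evaluation of a current at `p` of mixed dimension on a smooth `k`-form (only the component of
dimension `k` contributes). -/
def evalForm (p : M) {k : ℕ} (α : DiffForm E M ∞ k) :
    (⨁ k, atomicCurrents E p k) →ₗ[ℝ] ℝ :=
  { toFun := fun T : atomicCurrents E p k => T.1 α
    map_add' := fun _ _ => rfl
    map_smul' := fun _ _ => rfl } ∘ₗ DirectSum.component ℝ ℕ (fun k => atomicCurrents E p k) k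

/-- The pairing of `α ⊗ β` with an element of the tensor square of the fibre at `p`,
`(α ⊗ β)(S ⊗ T) = α(S) β(T)`. -/
def evalTensor (p : M) {a b : ℕ} (α : DiffForm E M ∞ a) (β : DiffForm E M ∞ b) :
    (⨁ k, atomicCurrents E p k) ⊗[ℝ] (⨁ k, atomicCurrents E p k) →ₗ[ℝ] ℝ :=
  LinearMap.mul' ℝ ℝ ∘ₗ TensorProduct.map (evalForm p α) (evalForm p β)

end Currents

end

/-!
The smooth forms are a differential graded algebra, which the order of vanishing at `p` filters by
ideals `J ^ s` of finite codimension; the product is compatible with this filtration and `d` lowers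
it by one. Currents of order at most `r` supported at `p` are exactly the functionals that kill
`J ^ (r + 1)`: a functional which factors through the finite-dimensional space of `r`-jets is
continuous for the `C^r` topology, and conversely, by Taylor's formula, a form whose `r`-jet at `p`
vanishes can be cut off near `p` so as to become arbitrarily small in the `C^r` topology. By
continuity every current at `p` has finite order. Hence the fibre at `p` is the filtered dual of the
algebra of forms. By finite codimension, the transpose of the product takes values in the algebraic
tensor product. For it to respect the filtrations, the coproduct of `T` of order `r` is telescoped
along projections compatible with the chain of the `J ^ s`.
-/

noncomputable section

/-! ### Signed sums over permutations -/

section SignedSum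

variable {V N : Type*} [AddCommGroup N] {ι κ : Type*} [Fintype ι] [DecidableEq ι] [Fintype κ]
  [DecidableEq κ]

/-- The signed sum `∑ σ, sign σ • F (w ∘ σ)` over all permutations: the alternatization of `F`, but
for `F` which need not be multilinear and which may use the entries of `w` in any order. -/
def signedSum (F : (ι → V) → N) (w : ι → V) : N :=
  ∑ σ : Equiv.Perm ι, Equiv.Perm.sign σ • F (w ∘ σ)

lemma signedSum_sum {α : Type*} (s : Finset α) (F : α → (ι → V) → N) (w : ι → V) :
    signedSum (fun u => ∑ i ∈ s, F i u) w = ∑ i ∈ s, signedSum (F i) w := by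
  simp only [signedSum, Finset.smul_sum]
  exact Finset.sum_comm

lemma signedSum_smul {G : Type*} [Monoid G] [DistribMulAction G N] (c : G) (F : (ι → V) → N)
    (w : ι → V) : signedSum (fun u => c • F u) w = c • signedSum F w := by
  simp only [signedSum, Finset.smul_sum, Units.smul_def, smul_comm c]

lemma signedSum_mul_left {R : Type*} [NonUnitalNonAssocRing R] (c : R) (F : (ι → V) → R)
    (w : ι → V) : signedSum (fun u => c * F u) w = c * signedSum F w := by
  simp only [signedSum, Finset.mul_sum, Units.smul_def, mul_smul_comm]

lemma signedSum_mul_right {R : Type*} [NonUnitalNonAssocRing R] (F : (ι → V) → R) (c : R)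
    (w : ι → V) : signedSum (fun u => F u * c) w = signedSum F w * c := by
  simp only [signedSum, Finset.sum_mul, Units.smul_def, smul_mul_assoc]

lemma signedSum_comp_equiv (e : ι ≃ κ) (F : (ι → V) → N) (w : κ → V) :
    signedSum F (w ∘ e) = signedSum (fun u => F (u ∘ e)) w := by
  refine Fintype.sum_equiv e.permCongr _ _ fun σ => ?_
  rw [Equiv.Perm.sign_permCongr]
  congr 2
  funext i
  simp [Equiv.permCongr_apply]

lemma signedSum_comp_perm (τ : Equiv.Perm ι) (F : (ι → V) → N) (w : ι → V) :
    signedSum (fun u => F (u ∘ τ)) w = Equiv.Perm.sign τ • signedSum F w := by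
  rw [signedSum, signedSum, Finset.smul_sum]
  refine Fintype.sum_equiv (Equiv.mulRight τ) _ _ fun σ => ?_
  rw [Equiv.coe_mulRight, Equiv.Perm.sign_mul, smul_smul, mul_comm, mul_assoc, Int.units_mul_self,
    mul_one]
  rfl

lemma signedSum_signedSum_inl (H : (ι → V) → (κ → V) → N) (w : ι ⊕ κ → V) :
    signedSum (fun u : ι ⊕ κ → V => signedSum (fun x => H x (u ∘ Sum.inr)) (u ∘ Sum.inl)) w =
      (Fintype.card ι).factorial •
        signedSum (fun u : ι ⊕ κ → V => H (u ∘ Sum.inl) (u ∘ Sum.inr)) w := by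
  set S := signedSum (fun u : ι ⊕ κ → V => H (u ∘ Sum.inl) (u ∘ Sum.inr)) w with hS
  have hterm (ρ : Equiv.Perm ι) : signedSum (fun u : ι ⊕ κ → V =>
      Equiv.Perm.sign ρ • H ((u ∘ Sum.inl) ∘ ρ) (u ∘ Sum.inr)) w = S := by
    have hperm := signedSum_comp_perm (ρ.sumCongr (1 : Equiv.Perm κ))
      (fun u : ι ⊕ κ → V => H (u ∘ Sum.inl) (u ∘ Sum.inr)) w
    rw [Equiv.Perm.sign_sumCongr, Equiv.Perm.sign_one, mul_one, ← hS] at hperm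
    rw [signedSum_smul, ← one_smul ℤˣ S, ← Int.units_mul_self (Equiv.Perm.sign ρ), mul_smul,
      ← hperm]
    rfl
  rw [← Fintype.card_perm, ← Finset.card_univ, ← Finset.sum_const, ← Finset.sum_congr rfl
    fun ρ _ => hterm ρ, ← signedSum_sum]
  rfl

variable {m n : ℕ}

lemma signedSum_signedSum_castAdd (H : (Fin m → V) → (Fin n → V) → N) (v : Fin (m + n) → V) :
    signedSum (fun u : Fin (m + n) → V =>
        signedSum (fun x => H x (u ∘ Fin.natAdd m)) (u ∘ Fin.castAdd n)) v =
      m.factorial • signedSum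
        (fun u : Fin (m + n) → V => H (u ∘ Fin.castAdd n) (u ∘ Fin.natAdd m)) v := by
  have h := signedSum_signedSum_inl H (v ∘ finSumFinEquiv)
  rwa [signedSum_comp_equiv, signedSum_comp_equiv, Fintype.card_fin] at h

lemma signedSum_signedSum_natAdd (H : (Fin m → V) → (Fin n → V) → N) (v : Fin (m + n) → V) :
    signedSum (fun u : Fin (m + n) → V =>
        signedSum (H (u ∘ Fin.castAdd n)) (u ∘ Fin.natAdd m)) v =
      n.factorial • signedSum
        (fun u : Fin (m + n) → V => H (u ∘ Fin.castAdd n) (u ∘ Fin.natAdd m)) v := by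
  have h := signedSum_signedSum_inl (fun y x => H x y)
    (v ∘ (Equiv.sumComm (Fin n) (Fin m)).trans finSumFinEquiv)
  rwa [signedSum_comp_equiv, signedSum_comp_equiv, Fintype.card_fin] at h

lemma signedSum_signedSum_tail (H : V → (Fin n → V) → N) (v : Fin (n + 1) → V) :
    signedSum (fun u : Fin (n + 1) → V => signedSum (H (u 0)) (Fin.tail u)) v =
      n.factorial • signedSum (fun u : Fin (n + 1) → V => H (u 0) (Fin.tail u)) v := by
  have h := signedSum_signedSum_natAdd (fun (x : Fin 1 → V) y => H (x 0) y)
    (v ∘ finCongr (add_comm 1 n))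
  rw [signedSum_comp_equiv, signedSum_comp_equiv] at h
  have hsucc (u : Fin (n + 1) → V) :
      (u ∘ finCongr (add_comm 1 n)) ∘ Fin.natAdd 1 = Fin.tail u :=
    funext fun i => congrArg u (Fin.ext (by simp))
  have hzero (u : Fin (n + 1) → V) : ((u ∘ finCongr (add_comm 1 n)) ∘ Fin.castAdd n) 0 = u 0 := rfl
  simpa only [hsucc, hzero] using h

end SignedSum

/-! ### The algebra of alternating forms -/

section WedgeAlgebra

variable {V : Type*} [AddCommGroup V] [Module ℝ V] [TopologicalSpace V] {a b c : ℕ}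

lemma factorial_mul_eq_signedSum (f : V [⋀^Fin a]→L[ℝ] ℝ) (w : Fin a → V) :
    a.factorial * f w = signedSum f w := by
  have hterm (σ : Equiv.Perm (Fin a)) : Equiv.Perm.sign σ • f (w ∘ σ) = f w := by
    rw [show f (w ∘ σ) = Equiv.Perm.sign σ • f w from f.toAlternatingMap.map_perm w σ, smul_smul,
      Int.units_mul_self, one_smul]
  simp [signedSum, hterm, Fintype.card_perm]

lemma factorial_mul_altWedge (f : V [⋀^Fin a]→L[ℝ] ℝ) (g : V [⋀^Fin b]→L[ℝ] ℝ)
    (v : Fin (a + b) → V) :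
    a.factorial * b.factorial * altWedge f g v = signedSum (fun u : Fin (a + b) → V =>
      f (u ∘ Fin.castAdd b) * g (u ∘ Fin.natAdd a)) v := by
  have hsum : ((a.factorial * b.factorial : ℕ) : ℝ) * altWedge f g v = signedSum
      (fun u => f (u ∘ Sum.inl) * g (u ∘ Sum.inr)) (v ∘ finSumFinEquiv) := by
    have h := congrArg (fun F => LinearMap.mul' ℝ ℝ (F (v ∘ finSumFinEquiv)))
      (MultilinearMap.domCoprod_alternization_eq f.toAlternatingMap g.toAlternatingMap)
    simp only [MultilinearMap.alternatization_apply, AlternatingMap.smul_apply, map_sum, map_nsmul,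
      Fintype.card_fin] at h
    rw [nsmul_eq_mul] at h
    refine h.symm.trans (Finset.sum_congr rfl fun σ _ => ?_)
    rw [Units.smul_def, map_zsmul]
    rfl
  rw [← Nat.cast_mul, hsum, signedSum_comp_equiv]
  rfl

/-- A form `f` with `r * f = signedSum F` need not be multiplied out: `F` can replace it under the
signed sum which computes `f ∧ g`. -/
lemma mul_altWedge_eq_signedSum_left {r : ℝ} {f : V [⋀^Fin a]→L[ℝ] ℝ} {F : (Fin a → V) → ℝ}
    (hF : ∀ x, r * f x = signedSum F x) (g : V [⋀^Fin b]→L[ℝ] ℝ) (v : Fin (a + b) → V) :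
    r * b.factorial * altWedge f g v = signedSum (fun u : Fin (a + b) → V =>
      F (u ∘ Fin.castAdd b) * g (u ∘ Fin.natAdd a)) v := by
  refine mul_left_cancel₀ (Nat.cast_ne_zero.2 a.factorial_ne_zero : (a.factorial : ℝ) ≠ 0) ?_
  calc a.factorial * (r * b.factorial * altWedge f g v)
      = r * (a.factorial * b.factorial * altWedge f g v) := by ring
    _ = signedSum (fun u : Fin (a + b) → V =>
          signedSum (fun x => F x * g (u ∘ Fin.natAdd a)) (u ∘ Fin.castAdd b)) v := by
        rw [factorial_mul_altWedge, ← signedSum_mul_left]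
        simp only [signedSum_mul_right, ← hF, mul_assoc]
    _ = _ := by
        rw [signedSum_signedSum_castAdd (fun x y => F x * g y), nsmul_eq_mul]

lemma mul_altWedge_eq_signedSum_right {r : ℝ} {g : V [⋀^Fin b]→L[ℝ] ℝ} {G : (Fin b → V) → ℝ}
    (f : V [⋀^Fin a]→L[ℝ] ℝ) (hG : ∀ y, r * g y = signedSum G y) (v : Fin (a + b) → V) :
    a.factorial * r * altWedge f g v = signedSum (fun u : Fin (a + b) → V =>
      f (u ∘ Fin.castAdd b) * G (u ∘ Fin.natAdd a)) v := by
  refine mul_left_cancel₀ (Nat.cast_ne_zero.2 b.factorial_ne_zero : (b.factorial : ℝ) ≠ 0) ?_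
  calc b.factorial * (a.factorial * r * altWedge f g v)
      = r * (a.factorial * b.factorial * altWedge f g v) := by ring
    _ = signedSum (fun u : Fin (a + b) → V =>
          signedSum (fun y => f (u ∘ Fin.castAdd b) * G y) (u ∘ Fin.natAdd a)) v := by
        rw [factorial_mul_altWedge, ← signedSum_mul_left]
        simp only [signedSum_mul_left, ← hG, mul_left_comm r]
    _ = _ := by
        rw [signedSum_signedSum_natAdd (fun x y => f x * G y), nsmul_eq_mul]

lemma altWedge_assoc (f : V [⋀^Fin a]→L[ℝ] ℝ) (g : V [⋀^Fin b]→L[ℝ] ℝ)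
    (h : V [⋀^Fin c]→L[ℝ] ℝ) (v : Fin (a + (b + c)) → V) :
    altWedge (altWedge f g) h (v ∘ finCongr (add_assoc a b c)) = altWedge f (altWedge g h) v := by
  refine mul_left_cancel₀
    (by positivity : (a.factorial * b.factorial * c.factorial : ℝ) ≠ 0) ?_
  rw [mul_altWedge_eq_signedSum_left (factorial_mul_altWedge f g), mul_assoc (a.factorial : ℝ),
    mul_altWedge_eq_signedSum_right f (factorial_mul_altWedge g h), signedSum_comp_equiv]
  refine congrArg (signedSum · v) (funext fun u => ?_)
  rw [mul_assoc]
  congr 3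
  exact funext fun i => congrArg u (Fin.ext (add_assoc a b i))

lemma one_altWedge (g : V [⋀^Fin b]→L[ℝ] ℝ) (v : Fin b → V) :
    altWedge (ContinuousAlternatingMap.constOfIsEmpty ℝ V (Fin 0) (1 : ℝ)) g
      (v ∘ finCongr (zero_add b)) = g v := by
  refine mul_left_cancel₀ (Nat.cast_ne_zero.2 b.factorial_ne_zero : (b.factorial : ℝ) ≠ 0) ?_
  have h := factorial_mul_altWedge
    (ContinuousAlternatingMap.constOfIsEmpty ℝ V (Fin 0) (1 : ℝ)) g (v ∘ finCongr (zero_add b))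
  rw [Nat.factorial_zero, Nat.cast_one, one_mul] at h
  rw [h, factorial_mul_eq_signedSum, signedSum_comp_equiv]
  refine congrArg (signedSum · v) (funext fun u => ?_)
  rw [ContinuousAlternatingMap.constOfIsEmpty_apply, one_mul]
  exact congrArg g (funext fun i => congrArg u (Fin.ext (zero_add (i : ℕ))))

lemma altWedge_one (g : V [⋀^Fin b]→L[ℝ] ℝ) (v : Fin b → V) :
    altWedge g (ContinuousAlternatingMap.constOfIsEmpty ℝ V (Fin 0) (1 : ℝ)) v = g v := by
  refine mul_left_cancel₀ (Nat.cast_ne_zero.2 b.factorial_ne_zero : (b.factorial : ℝ) ≠ 0) ?_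
  have h := factorial_mul_altWedge g
    (ContinuousAlternatingMap.constOfIsEmpty ℝ V (Fin 0) (1 : ℝ)) v
  rw [Nat.factorial_zero, Nat.cast_one, mul_one] at h
  rw [h, factorial_mul_eq_signedSum]
  refine congrArg (signedSum · v) (funext fun u => ?_)
  rw [ContinuousAlternatingMap.constOfIsEmpty_apply, mul_one]
  rfl

end WedgeAlgebra

section AlternatizeUncurry

open ContinuousAlternatingMap (alternatizeUncurryFin)

variable {E : Type*} [NormedAddCommGroup E] [NormedSpace ℝ E] {a b n : ℕ}

lemma factorial_mul_alternatizeUncurryFin (L : E →L[ℝ] E [⋀^Fin n]→L[ℝ] ℝ)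
    (v : Fin (n + 1) → E) :
    n.factorial * alternatizeUncurryFin L v =
      signedSum (fun u : Fin (n + 1) → E => L (u 0) (Fin.tail u)) v := by
  have hremove (i : Fin (n + 1)) (u : Fin (n + 1) → E) :
      L (u i) (i.removeNth u) =
        L ((u ∘ i.cycleRange.symm) 0) (Fin.tail (u ∘ i.cycleRange.symm)) := by
    congr 2
    · simp
    · funext j
      simp [Fin.removeNth, Fin.tail]
  have hterm (i : Fin (n + 1)) :
      signedSum (fun u => (-1 : ℤ) ^ (i : ℕ) • L (u i) (i.removeNth u)) v =
        signedSum (fun u : Fin (n + 1) → E => L (u 0) (Fin.tail u)) v := by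
    simp only [hremove]
    rw [signedSum_smul, signedSum_comp_perm i.cycleRange.symm
      (fun u : Fin (n + 1) → E => L (u 0) (Fin.tail u)), Units.smul_def, smul_smul]
    simp [Equiv.Perm.sign_symm, ← mul_pow]
  refine mul_left_cancel₀ (Nat.cast_ne_zero.2 n.succ_ne_zero : ((n + 1 : ℕ) : ℝ) ≠ 0) ?_
  rw [← mul_assoc, ← Nat.cast_mul, ← Nat.factorial_succ, factorial_mul_eq_signedSum,
    show ⇑(alternatizeUncurryFin L) = _ from
      funext fun u => ContinuousAlternatingMap.alternatizeUncurryFin_apply L u,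
    signedSum_sum, Finset.sum_congr rfl fun i _ => hterm i]
  simp

lemma mul_alternatizeUncurryFin_eq_signedSum {r : ℝ} {L : E →L[ℝ] E [⋀^Fin n]→L[ℝ] ℝ}
    {H : E → (Fin n → E) → ℝ} (hH : ∀ x y, r * L x y = signedSum (H x) y)
    (v : Fin (n + 1) → E) :
    r * alternatizeUncurryFin L v =
      signedSum (fun u : Fin (n + 1) → E => H (u 0) (Fin.tail u)) v := by
  refine mul_left_cancel₀ (Nat.cast_ne_zero.2 n.factorial_ne_zero : (n.factorial : ℝ) ≠ 0) ?_
  rw [mul_left_comm, factorial_mul_alternatizeUncurryFin, ← signedSum_mul_left]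
  simp only [hH]
  rw [signedSum_signedSum_tail, nsmul_eq_mul]

lemma alternatizeUncurryFin_altWedge_left (L : E →L[ℝ] E [⋀^Fin a]→L[ℝ] ℝ)
    (g : E [⋀^Fin b]→L[ℝ] ℝ) (L' : E →L[ℝ] E [⋀^Fin (a + b)]→L[ℝ] ℝ)
    (hL' : ∀ x, L' x = altWedge (L x) g) (v : Fin (a + b + 1) → E) :
    alternatizeUncurryFin L' v =
      altWedge (alternatizeUncurryFin L) g (v ∘ finCongr (Nat.add_right_comm a 1 b)) := by
  refine mul_left_cancel₀ (by positivity : (a.factorial * b.factorial : ℝ) ≠ 0) ?_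
  rw [mul_alternatizeUncurryFin_eq_signedSum
      (fun x y => by rw [hL']; exact factorial_mul_altWedge (L x) g y),
    mul_altWedge_eq_signedSum_left (factorial_mul_alternatizeUncurryFin L), signedSum_comp_equiv]
  refine congrArg (signedSum · v) (funext fun u => ?_)
  congr 2
  exact funext fun i => congrArg u (Fin.ext (Nat.add_right_comm a i 1))

/-- The sign is that of the cycle which moves the argument of the derivative past those of `f`. -/
lemma alternatizeUncurryFin_altWedge_right (f : E [⋀^Fin a]→L[ℝ] ℝ)
    (L : E →L[ℝ] E [⋀^Fin b]→L[ℝ] ℝ) (L' : E →L[ℝ] E [⋀^Fin (a + b)]→L[ℝ] ℝ)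
    (hL' : ∀ x, L' x = altWedge f (L x)) (v : Fin (a + b + 1) → E) :
    alternatizeUncurryFin L' v = (-1) ^ a * altWedge f (alternatizeUncurryFin L) v := by
  refine mul_left_cancel₀ (by positivity : (a.factorial * b.factorial : ℝ) ≠ 0) ?_
  rw [mul_left_comm, mul_alternatizeUncurryFin_eq_signedSum
      (fun x y => by rw [hL']; exact factorial_mul_altWedge f (L x) y),
    mul_altWedge_eq_signedSum_right f (factorial_mul_alternatizeUncurryFin L)]
  let j : Fin (a + b + 1) := ⟨a, by omega⟩
  have hj := signedSum_comp_perm j.cycleRange (fun u : Fin (a + b + 1) → E =>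
    f (u ∘ Fin.castAdd (b + 1)) * L (u (Fin.natAdd a (0 : Fin (b + 1))))
      (Fin.tail (u ∘ Fin.natAdd a))) v
  rw [Fin.sign_cycleRange, Units.smul_def, zsmul_eq_mul] at hj
  push_cast at hj
  refine Eq.trans (congrArg (signedSum · v) (funext fun u => ?_)) hj
  have hlt (i : Fin a) : j.cycleRange (Fin.castAdd (b + 1) i) = (Fin.castAdd b i).succ :=
    Fin.ext (by rw [Fin.coe_cycleRange_of_lt (by simp [Fin.lt_def, j])]; simp)
  have hself : j.cycleRange (Fin.natAdd a (0 : Fin (b + 1))) = 0 := Fin.cycleRange_self j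
  have hgt (i : Fin b) : j.cycleRange (Fin.natAdd a i.succ) = (Fin.natAdd a i).succ := by
    rw [Fin.cycleRange_of_gt (by simp [Fin.lt_def, j])]
    rfl
  simp only [Function.comp_def, Fin.tail_def, hlt, hself, hgt]

end AlternatizeUncurry

/-! ### Tensor products and separating families of functionals -/

section TensorFunctional

open Module (Dual)

variable {K U V W : Type*}

section CommRing

variable [CommRing K] [AddCommGroup U] [Module K U] [AddCommGroup V] [Module K V]
  [AddCommGroup W] [Module K W]

/-- The functional `u ⊗ v ↦ f u * g v` on a tensor product. -/
def tensorFunctional (f : Dual K U) (g : Dual K V) : Dual K (U ⊗[K] V) :=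
  LinearMap.mul' K K ∘ₗ TensorProduct.map f g

lemma tensorFunctional_tmul (f : Dual K U) (g : Dual K V) (u : U) (v : V) :
    tensorFunctional f g (u ⊗ₜ v) = f u * g v := by
  simp [tensorFunctional]

lemma tensorFunctional_comp_map {U' V' : Type*} [AddCommGroup U'] [Module K U'] [AddCommGroup V']
    [Module K V'] (f : Dual K U) (g : Dual K V) (φ : U' →ₗ[K] U) (ψ : V' →ₗ[K] V) :
    tensorFunctional f g ∘ₗ TensorProduct.map φ ψ = tensorFunctional (f ∘ₗ φ) (g ∘ₗ ψ) := by
  rw [tensorFunctional, LinearMap.comp_assoc, ← TensorProduct.map_comp]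
  rfl

lemma tensorFunctional_comp_assoc (f : Dual K U) (g : Dual K V) (h : Dual K W) :
    tensorFunctional f (tensorFunctional g h) ∘ₗ (TensorProduct.assoc K U V W).toLinearMap =
      tensorFunctional (tensorFunctional f g) h :=
  TensorProduct.ext_threefold fun u v w => by simp [tensorFunctional, mul_assoc]

lemma tensorFunctional_smul_left (c : K) (f : Dual K U) (g : Dual K V) :
    tensorFunctional (c • f) g = c • tensorFunctional f g := by
  rw [tensorFunctional, TensorProduct.map_smul_left, LinearMap.comp_smul]
  rfl

lemma tensorFunctional_zero_left (g : Dual K V) :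
    tensorFunctional (0 : Dual K U) g = 0 := by
  rw [tensorFunctional, TensorProduct.map_zero_left, LinearMap.comp_zero]

lemma tensorFunctional_zero_right (f : Dual K U) :
    tensorFunctional f (0 : Dual K V) = 0 := by
  rw [tensorFunctional, TensorProduct.map_zero_right, LinearMap.comp_zero]

lemma eq_of_forall_comp_eq {ι : Type*} {f : ι → Dual K V}
    (hf : Function.Injective (LinearMap.pi f)) {φ ψ : U →ₗ[K] V}
    (h : ∀ i, f i ∘ₗ φ = f i ∘ₗ ψ) : φ = ψ :=
  LinearMap.ext fun u => hf (funext fun i => LinearMap.congr_fun (h i) u)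

end CommRing

variable [Field K] [AddCommGroup U] [Module K U] [AddCommGroup V] [Module K V]

lemma eq_zero_of_forall_lTensor_eq_zero {κ : Type*} {g : κ → Dual K V}
    (hg : Function.Injective (LinearMap.pi g)) {x : U ⊗[K] V}
    (hx : ∀ j, (g j).lTensor U x = 0) : x = 0 := by
  classical
  let b := Module.Basis.ofVectorSpace K U
  have hcoord (j : κ) (y : U ⊗[K] V) (m) :
      TensorProduct.equivFinsuppOfBasisLeft b ((g j).lTensor U y) m =
        g j (TensorProduct.equivFinsuppOfBasisLeft b y m) := by
    induction y with
    | zero => simp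
    | add y z hy hz => simp only [map_add, Finsupp.add_apply, hy, hz]
    | tmul u v => simp
  refine (TensorProduct.equivFinsuppOfBasisLeft b).map_eq_zero_iff.1 (Finsupp.ext fun m => hg ?_)
  rw [Finsupp.zero_apply, map_zero]
  funext j
  rw [LinearMap.pi_apply, ← hcoord, hx, map_zero, Finsupp.zero_apply, Pi.zero_apply]

lemma injective_pi_tensorFunctional {ι κ : Type*} {f : ι → Dual K U} {g : κ → Dual K V}
    (hf : Function.Injective (LinearMap.pi f)) (hg : Function.Injective (LinearMap.pi g)) :
    Function.Injective
      (LinearMap.pi fun ij : ι × κ => tensorFunctional (f ij.1) (g ij.2)) := by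
  have hcontract (i : ι) (j : κ) (y : U ⊗[K] V) :
      f i (TensorProduct.rid K U ((g j).lTensor U y)) = tensorFunctional (f i) (g j) y := by
    induction y with
    | zero => simp
    | add y z hy hz => simp only [map_add, hy, hz]
    | tmul u v => simp [tensorFunctional, mul_comm]
  rw [injective_iff_map_eq_zero]
  refine fun x hx => eq_zero_of_forall_lTensor_eq_zero hg fun j => ?_
  refine (TensorProduct.rid K U).map_eq_zero_iff.1 (hf ?_)
  rw [map_zero]
  exact funext fun i => (hcontract i j x).trans (congrFun hx (i, j))

end TensorFunctional

section FilteredBilinear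

open Module (Dual)

variable {K A A' U U' : Type*} [Field K] [AddCommGroup A] [Module K A] [AddCommGroup A']
  [Module K A'] [AddCommGroup U] [Module K U] [AddCommGroup U'] [Module K U']

lemma exists_tensorFunctional_eq_of_le_ker {e : U →ₗ[K] Dual K A} {e' : U' →ₗ[K] Dual K A'}
    {F : Submodule K U} {F' : Submodule K U'} {J : Submodule K A} [FiniteDimensional K (A ⧸ J)]
    (hF : J.dualAnnihilator ≤ F.map e) {B : A →ₗ[K] Dual K A'} (hJ : J ≤ LinearMap.ker B)
    (hB : LinearMap.range B ≤ F'.map e') :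
    ∃ x ∈ LinearMap.range (TensorProduct.mapIncl F F'),
      ∀ α β, tensorFunctional (e.flip α) (e'.flip β) x = B α β := by
  let b := Module.finBasis K (A ⧸ J)
  have hcoord (m) : b.coord m ∘ₗ J.mkQ ∈ J.dualAnnihilator :=
    (Submodule.mem_dualAnnihilator _).2 fun α hα => by
      simp [(Submodule.Quotient.mk_eq_zero _).2 hα]
  choose u huF hu using fun m => hF (hcoord m)
  choose c hc using fun m => J.mkQ_surjective (b m)
  choose w hwF hw using fun m => hB (LinearMap.mem_range_self B (c m))
  refine ⟨∑ m, u m ⊗ₜ w m, Submodule.sum_mem _ fun m _ =>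
    ⟨(⟨u m, huF m⟩ : F) ⊗ₜ (⟨w m, hwF m⟩ : F'), by simp [TensorProduct.mapIncl]⟩, fun α β => ?_⟩
  have hα : B α = ∑ m, b.coord m (J.mkQ α) • B (c m) := by
    have hmem : α - ∑ m, b.coord m (J.mkQ α) • c m ∈ J := by
      rw [← Submodule.Quotient.mk_eq_zero, ← Submodule.mkQ_apply, map_sub, sub_eq_zero, map_sum]
      simp only [map_smul, hc]
      exact (b.sum_repr _).symm
    simpa [sub_eq_zero] using hJ hmem
  simp [hα, tensorFunctional_tmul, hu, hw]

lemma exists_isProj (J : Submodule K A) : ∃ Q : A →ₗ[K] A, LinearMap.IsProj J Q := by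
  obtain ⟨q, hq⟩ := J.subtype.exists_leftInverse_of_injective J.ker_subtype
  exact ⟨J.subtype ∘ₗ q, fun α => (q α).2,
    fun α hα => congrArg J.subtype (LinearMap.congr_fun hq ⟨α, hα⟩)⟩

/-- With projections `Q s` onto `J s`, the form `B` telescopes into the sum of the forms
`B ∘ (Q s - Q (s + 1))`, which factor through `J s / J (s + 1)` in the first variable and therefore
vanish on `J' (r + 1 - s)` in the second. -/
lemma exists_tensorFunctional_eq_of_filtered {e : U →ₗ[K] Dual K A} {e' : U' →ₗ[K] Dual K A'}
    {F : ℕ → Submodule K U} {F' : ℕ → Submodule K U'} {J : ℕ → Submodule K A}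
    {J' : ℕ → Submodule K A'} (hJ_zero : J 0 = ⊤) (hJ'_zero : J' 0 = ⊤) (hJ : Antitone J)
    [∀ s, FiniteDimensional K (A ⧸ J s)] (hF : ∀ s, (J (s + 1)).dualAnnihilator ≤ (F s).map e)
    (hF' : ∀ s, (J' (s + 1)).dualAnnihilator ≤ (F' s).map e') {B : A →ₗ[K] Dual K A'} {r : ℕ}
    (hB : ∀ s t, s + t = r + 1 → ∀ α ∈ J s, ∀ β ∈ J' t, B α β = 0) :
    ∃ x ∈ ⨆ st ∈ Finset.HasAntidiagonal.antidiagonal r,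
        LinearMap.range (TensorProduct.mapIncl (F st.1) (F' st.2)),
      ∀ α β, tensorFunctional (e.flip α) (e'.flip β) x = B α β := by
  choose Q hQ using fun s => exists_isProj (J s)
  have hpiece (st : ℕ × ℕ) (hst : st ∈ Finset.HasAntidiagonal.antidiagonal r) :
      ∃ x ∈ LinearMap.range (TensorProduct.mapIncl (F st.1) (F' st.2)),
        ∀ α β, tensorFunctional (e.flip α) (e'.flip β) x =
          B (Q st.1 α) β - B (Q (st.1 + 1) α) β := by
    obtain ⟨s, t⟩ := st
    have hmem (α : A) : Q s α - Q (s + 1) α ∈ J s :=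
      (J s).sub_mem ((hQ s).map_mem α) (hJ s.le_succ ((hQ (s + 1)).map_mem α))
    have hker : J (s + 1) ≤ LinearMap.ker (B ∘ₗ (Q s - Q (s + 1))) := fun α hα => by
      simp [(hQ s).map_id α (hJ s.le_succ hα), (hQ (s + 1)).map_id α hα]
    have hrange : LinearMap.range (B ∘ₗ (Q s - Q (s + 1))) ≤ (F' t).map e' := by
      rintro _ ⟨α, rfl⟩
      refine hF' t ((Submodule.mem_dualAnnihilator _).2 fun β hβ => hB s (t + 1) ?_ _ (hmem α) β hβ)
      rw [← add_assoc, Finset.HasAntidiagonal.mem_antidiagonal.1 hst]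
    simpa using exists_tensorFunctional_eq_of_le_ker (hF s) hker hrange
  choose! x hxF hx using hpiece
  refine ⟨∑ st ∈ Finset.HasAntidiagonal.antidiagonal r, x st, Submodule.sum_mem _ fun st hst =>
    Submodule.mem_iSup_of_mem st (Submodule.mem_iSup_of_mem hst (hxF st hst)), fun α β => ?_⟩
  have hzero : B (Q (r + 1) α) β = 0 :=
    hB (r + 1) 0 rfl _ ((hQ (r + 1)).map_mem α) β (hJ'_zero ▸ Submodule.mem_top)
  have hid : Q 0 α = α := (hQ 0).map_id α (hJ_zero ▸ Submodule.mem_top)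
  rw [map_sum, Finset.sum_congr rfl fun st hst => hx st hst α β,
    Finset.Nat.sum_antidiagonal_eq_sum_range_succ_mk,
    Finset.sum_range_sub' (fun s => B (Q s α) β), hzero, hid, sub_zero]

end FilteredBilinear

/-! ### The coalgebra dual to a filtered differential graded algebra -/

section TotalPairing

open Module (Dual)

variable {A U : ℕ → Type*} [∀ k, AddCommGroup (A k)] [∀ k, Module ℝ (A k)]
  [∀ k, AddCommGroup (U k)] [∀ k, Module ℝ (U k)] (e : ∀ k, U k →ₗ[ℝ] Dual ℝ (A k)) {a b k l : ℕ}

/-- The functional on `⨁ k, U k` given by an element of `A k`, through the pairing of `A k` with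
the component of degree `k`. -/
def totalPairing (α : A k) : Dual ℝ (⨁ k, U k) :=
  (e k).flip α ∘ₗ DirectSum.component ℝ ℕ U k

/-- The functional on the tensor square of `⨁ k, U k` given by a pair of homogeneous elements. -/
def tensorPairing (α : A a) (β : A b) : Dual ℝ ((⨁ k, U k) ⊗[ℝ] (⨁ k, U k)) :=
  tensorFunctional (totalPairing e α) (totalPairing e β)

lemma totalPairing_comp_lof (α : A k) :
    totalPairing e α ∘ₗ DirectSum.lof ℝ ℕ U k = (e k).flip α :=
  LinearMap.ext fun T => by simp [totalPairing, DirectSum.component.lof_self]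

lemma totalPairing_comp_lof_of_ne (h : l ≠ k) (α : A k) :
    totalPairing e α ∘ₗ DirectSum.lof ℝ ℕ U l = 0 :=
  LinearMap.ext fun T => by simp [totalPairing, DirectSum.component.of, h]

lemma totalPairing_lof (α : A k) (T : U k) :
    totalPairing e α (DirectSum.lof ℝ ℕ U k T) = e k T α :=
  LinearMap.congr_fun (totalPairing_comp_lof e α) T

lemma totalPairing_lof_of_ne (h : l ≠ k) (α : A k) (T : U l) :
    totalPairing e α (DirectSum.lof ℝ ℕ U l T) = 0 :=
  LinearMap.congr_fun (totalPairing_comp_lof_of_ne e h α) T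

lemma tensorPairing_map_lof (α : A a) (β : A b) (x : U a ⊗[ℝ] U b) :
    tensorPairing e α β
        (TensorProduct.map (DirectSum.lof ℝ ℕ U a) (DirectSum.lof ℝ ℕ U b) x) =
      tensorFunctional ((e a).flip α) ((e b).flip β) x := by
  rw [tensorPairing, ← LinearMap.comp_apply, tensorFunctional_comp_map, totalPairing_comp_lof,
    totalPairing_comp_lof]

lemma tensorPairing_map_lof_of_ne {c d : ℕ} (h : (c, d) ≠ (a, b)) (α : A a) (β : A b)
    (x : U c ⊗[ℝ] U d) :
    tensorPairing e α β
      (TensorProduct.map (DirectSum.lof ℝ ℕ U c) (DirectSum.lof ℝ ℕ U d) x) = 0 := by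
  rw [tensorPairing, ← LinearMap.comp_apply, tensorFunctional_comp_map]
  by_cases hc : c = a
  · have hd : d ≠ b := fun hd => h (Prod.ext hc hd)
    rw [totalPairing_comp_lof_of_ne e hd, tensorFunctional_zero_right, LinearMap.zero_apply]
  · rw [totalPairing_comp_lof_of_ne e hc, tensorFunctional_zero_left, LinearMap.zero_apply]

variable {e}

lemma injective_pi_totalPairing (he : ∀ k, Function.Injective (e k)) :
    Function.Injective (LinearMap.pi fun i : Σ k, A k => totalPairing e i.2) :=
  fun _ _ h => DirectSum.ext_component ℝ fun k => he k <| LinearMap.ext fun α =>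
    congrFun h ⟨k, α⟩

lemma injective_pi_tensorPairing (he : ∀ k, Function.Injective (e k)) :
    Function.Injective (LinearMap.pi fun i : (Σ k, A k) × (Σ k, A k) =>
      tensorPairing e i.1.2 i.2.2) :=
  injective_pi_tensorFunctional (f := fun i : Σ k, A k => totalPairing e i.2)
    (g := fun i : Σ k, A k => totalPairing e i.2) (injective_pi_totalPairing he)
    (injective_pi_totalPairing he)

lemma totalPairing_comp_gradingSign (α : A k) :
    totalPairing e α ∘ₗ gradingSign U = (-1 : ℝ) ^ k • totalPairing e α := by
  refine DirectSum.linearMap_ext ℝ fun l => LinearMap.ext fun T => ?_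
  simp only [LinearMap.comp_apply, LinearMap.smul_apply, gradingSign, DirectSum.toModule_lof,
    map_smul]
  rcases eq_or_ne l k with rfl | h
  · rfl
  · rw [totalPairing_lof_of_ne e h, smul_zero, smul_zero]

lemma map_lof_mem_tensorFiltration {F : ∀ k, ℕ → Submodule ℝ (U k)} {r : ℕ}
    {ab : ℕ × ℕ} (hab : ab ∈ Finset.HasAntidiagonal.antidiagonal l) {x : U ab.1 ⊗[ℝ] U ab.2}
    (hx : x ∈ ⨆ st ∈ Finset.HasAntidiagonal.antidiagonal r,
      LinearMap.range (TensorProduct.mapIncl (F ab.1 st.1) (F ab.2 st.2))) :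
    TensorProduct.map (DirectSum.lof ℝ ℕ U ab.1) (DirectSum.lof ℝ ℕ U ab.2) x ∈
      tensorFiltration F l r := by
  refine Submodule.mem_iSup_of_mem ab (Submodule.mem_iSup_of_mem hab ?_)
  simp only [TensorProduct.map_comp, LinearMap.range_comp, ← Submodule.map_iSup]
  exact Submodule.mem_map_of_mem hx

end TotalPairing

section FilteredDuality

open Module (Dual)

universe u

variable {A : ℕ → Type*} {U : ℕ → Type u} [∀ k, AddCommGroup (A k)] [∀ k, Module ℝ (A k)]
  [∀ k, AddCommGroup (U k)] [∀ k, Module ℝ (U k)] {F : ∀ k, ℕ → Submodule ℝ (U k)}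

/-- A differential graded algebra `A` with a decreasing filtration `J` of finite codimension, in
duality with graded vector spaces `U k` whose filtration `F k r` consists of all functionals on
`A k` that annihilate `J k (r + 1)`. The associativity, unit and Leibniz laws relate elements of
degrees that are only propositionally equal; they are stated for the functionals on `⨁ k, U k`
given by both sides, which avoids casts. -/
structure FilteredDuality (A U : ℕ → Type*) [∀ k, AddCommGroup (A k)] [∀ k, Module ℝ (A k)]
    [∀ k, AddCommGroup (U k)] [∀ k, Module ℝ (U k)] (F : ∀ k, ℕ → Submodule ℝ (U k)) where
  pair : ∀ k, U k →ₗ[ℝ] Dual ℝ (A k)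
  one : A 0
  mul : ∀ a b, A a →ₗ[ℝ] A b →ₗ[ℝ] A (a + b)
  d : ∀ k, A k →ₗ[ℝ] A (k + 1)
  J : ∀ k, ℕ → Submodule ℝ (A k)
  J_zero : ∀ k, J k 0 = ⊤
  J_antitone : ∀ k, Antitone (J k)
  J_finite : ∀ k s, FiniteDimensional ℝ (A k ⧸ J k s)
  mul_mem : ∀ {a b s t} {α : A a} {β : A b}, α ∈ J a s → β ∈ J b t → mul a b α β ∈ J (a + b) (s + t)
  d_mem : ∀ {k s} {α : A k}, α ∈ J k (s + 1) → d k α ∈ J (k + 1) s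
  pair_injective : ∀ k, Function.Injective (pair k)
  map_pair : ∀ k r, (F k r).map (pair k) = (J k (r + 1)).dualAnnihilator
  exhaustive : ∀ k (T : U k), ∃ r, T ∈ F k r
  mul_assoc : ∀ {a b c} (α : A a) (β : A b) (γ : A c),
    totalPairing pair (mul _ _ (mul _ _ α β) γ) = totalPairing pair (mul _ _ α (mul _ _ β γ))
  one_mul : ∀ {b} (β : A b), totalPairing pair (mul _ _ one β) = totalPairing pair β
  mul_one : ∀ {b} (β : A b), totalPairing pair (mul _ _ β one) = totalPairing pair β
  leibniz : ∀ {a b} (α : A a) (β : A b), totalPairing pair (d _ (mul _ _ α β)) =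
    totalPairing pair (mul _ _ (d _ α) β) + (-1 : ℝ) ^ a • totalPairing pair (mul _ _ α (d _ β))
  d_d : ∀ {k} (α : A k), d _ (d _ α) = 0
  d_one : d _ one = 0

namespace FilteredDuality

variable (D : FilteredDuality A U F) {a b k l r : ℕ}

include D in
lemma monotone_filtration (k : ℕ) : Monotone (F k) := fun r s hrs => by
  rw [← Submodule.map_le_map_iff_of_injective (D.pair_injective k), D.map_pair, D.map_pair]
  exact Submodule.dualAnnihilator_anti (D.J_antitone k (Nat.succ_le_succ hrs))

lemma mem_filtration_iff {T : U k} : T ∈ F k r ↔ ∀ α ∈ D.J k (r + 1), D.pair k T α = 0 := by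
  rw [← Submodule.mem_dualAnnihilator, ← D.map_pair, Submodule.mem_map]
  exact ⟨fun hT => ⟨T, hT, rfl⟩, fun ⟨S, hS, hST⟩ => D.pair_injective k hST ▸ hS⟩

lemma exists_tensor_of_degree (ab : ℕ × ℕ) {T : U (ab.1 + ab.2)} (hT : T ∈ F (ab.1 + ab.2) r) :
    ∃ x ∈ ⨆ st ∈ Finset.HasAntidiagonal.antidiagonal r,
        LinearMap.range (TensorProduct.mapIncl (F ab.1 st.1) (F ab.2 st.2)),
      ∀ α β, tensorFunctional ((D.pair ab.1).flip α) ((D.pair ab.2).flip β) x =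
        D.pair (ab.1 + ab.2) T (D.mul ab.1 ab.2 α β) := by
  have := D.J_finite ab.1
  exact exists_tensorFunctional_eq_of_filtered (D.J_zero ab.1) (D.J_zero ab.2) (D.J_antitone ab.1)
    (fun s => (D.map_pair ab.1 s).ge) (fun s => (D.map_pair ab.2 s).ge)
    (B := (D.mul ab.1 ab.2).compr₂ (D.pair (ab.1 + ab.2) T))
    fun s t hst α hα β hβ => D.mem_filtration_iff.1 hT _ (hst ▸ D.mul_mem hα hβ)

lemma exists_mem_tensorFiltration {T : U l} (hT : T ∈ F l r) :
    ∃ x ∈ tensorFiltration F l r, ∀ {a b : ℕ} (α : A a) (β : A b),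
      tensorPairing D.pair α β x =
        totalPairing D.pair (D.mul a b α β) (DirectSum.lof ℝ ℕ U l T) := by
  have hab (ab : ℕ × ℕ) (h : ab ∈ Finset.HasAntidiagonal.antidiagonal l) :
      ∃ x ∈ ⨆ st ∈ Finset.HasAntidiagonal.antidiagonal r,
          LinearMap.range (TensorProduct.mapIncl (F ab.1 st.1) (F ab.2 st.2)),
        ∀ α β, tensorFunctional ((D.pair ab.1).flip α) ((D.pair ab.2).flip β) x =
          totalPairing D.pair (D.mul ab.1 ab.2 α β) (DirectSum.lof ℝ ℕ U l T) := by
    obtain rfl := Finset.HasAntidiagonal.mem_antidiagonal.1 h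
    simpa only [totalPairing_lof] using D.exists_tensor_of_degree ab hT
  choose! x hxF hx using hab
  refine ⟨∑ ab ∈ Finset.HasAntidiagonal.antidiagonal l,
    TensorProduct.map (DirectSum.lof ℝ ℕ U ab.1) (DirectSum.lof ℝ ℕ U ab.2) (x ab),
    Submodule.sum_mem _ fun ab h => map_lof_mem_tensorFiltration h (hxF ab h),
    fun {a b} α β => ?_⟩
  have hne : ∀ ab ∈ Finset.HasAntidiagonal.antidiagonal l, ab ≠ (a, b) →
      tensorPairing D.pair α β
        (TensorProduct.map (DirectSum.lof ℝ ℕ U ab.1) (DirectSum.lof ℝ ℕ U ab.2) (x ab)) = 0 :=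
    fun ab _ h => tensorPairing_map_lof_of_ne D.pair h α β (x ab)
  rw [map_sum]
  by_cases hl : (a, b) ∈ Finset.HasAntidiagonal.antidiagonal l
  · rw [Finset.sum_eq_single_of_mem _ hl hne, tensorPairing_map_lof, hx _ hl]
  · rw [Finset.sum_eq_zero fun ab h => hne ab h fun hab => hl (hab ▸ h),
      totalPairing_lof_of_ne D.pair fun h =>
        hl (Finset.HasAntidiagonal.mem_antidiagonal.2 h.symm)]

lemma exists_tensorPairing_eq (T : ⨁ k, U k) :
    ∃ x, LinearMap.pi (fun i : (Σ k, A k) × (Σ k, A k) => tensorPairing D.pair i.1.2 i.2.2) x =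
      LinearMap.pi (fun i : (Σ k, A k) × (Σ k, A k) =>
        totalPairing D.pair (D.mul _ _ i.1.2 i.2.2)) T := by
  induction T using DirectSum.induction_on with
  | zero => exact ⟨0, by simp only [map_zero]⟩
  | add S T hS hT =>
    obtain ⟨x, hx⟩ := hS
    obtain ⟨y, hy⟩ := hT
    exact ⟨x + y, by rw [map_add, map_add, hx, hy]⟩
  | of l T =>
    obtain ⟨r, hr⟩ := D.exhaustive l T
    obtain ⟨x, -, hx⟩ := D.exists_mem_tensorFiltration hr
    exact ⟨x, funext fun i => hx i.1.2 i.2.2⟩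

/-- The coproduct: the transpose of the product, which by finite codimension of the filtration
takes values in the algebraic tensor product. -/
def comul : (⨁ k, U k) →ₗ[ℝ] (⨁ k, U k) ⊗[ℝ] (⨁ k, U k) :=
  LinearMap.codRestrictOfInjective
    (LinearMap.pi fun i : (Σ k, A k) × (Σ k, A k) =>
      totalPairing D.pair (D.mul _ _ i.1.2 i.2.2))
    _ (injective_pi_tensorPairing D.pair_injective) D.exists_tensorPairing_eq

lemma tensorPairing_comul (α : A a) (β : A b) (T : ⨁ k, U k) :
    tensorPairing D.pair α β (D.comul T) = totalPairing D.pair (D.mul a b α β) T :=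
  congrFun (LinearMap.codRestrictOfInjective_comp_apply _ _
    (injective_pi_tensorPairing D.pair_injective) D.exists_tensorPairing_eq T) (⟨a, α⟩, ⟨b, β⟩)

lemma tensorPairing_comp_comul (α : A a) (β : A b) :
    tensorPairing D.pair α β ∘ₗ D.comul = totalPairing D.pair (D.mul a b α β) :=
  LinearMap.ext (D.tensorPairing_comul α β)

lemma comul_mem_tensorFiltration {T : U l} (hT : T ∈ F l r) :
    D.comul (DirectSum.lof ℝ ℕ U l T) ∈ tensorFiltration F l r := by
  obtain ⟨x, hxF, hx⟩ := D.exists_mem_tensorFiltration hT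
  convert hxF
  exact injective_pi_tensorPairing D.pair_injective <| funext fun i =>
    (D.tensorPairing_comul i.1.2 i.2.2 _).trans (hx i.1.2 i.2.2).symm

lemma assoc_comp_rTensor_comul_comp_comul :
    (TensorProduct.assoc ℝ _ _ _).toLinearMap ∘ₗ D.comul.rTensor _ ∘ₗ D.comul =
      D.comul.lTensor _ ∘ₗ D.comul := by
  refine eq_of_forall_comp_eq (injective_pi_tensorFunctional
    (injective_pi_totalPairing D.pair_injective)
    (injective_pi_tensorPairing D.pair_injective)) fun ⟨⟨a, α⟩, ⟨b, β⟩, ⟨c, γ⟩⟩ => ?_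
  calc tensorFunctional (totalPairing D.pair α) (tensorPairing D.pair β γ) ∘ₗ
        (TensorProduct.assoc ℝ _ _ _).toLinearMap ∘ₗ D.comul.rTensor _ ∘ₗ D.comul
      = (tensorFunctional (tensorPairing D.pair α β) (totalPairing D.pair γ) ∘ₗ
          TensorProduct.map D.comul LinearMap.id) ∘ₗ D.comul := by
        rw [tensorPairing, ← LinearMap.comp_assoc, tensorFunctional_comp_assoc]
        rfl
    _ = tensorPairing D.pair (D.mul a b α β) γ ∘ₗ D.comul := by
        rw [tensorFunctional_comp_map, tensorPairing_comp_comul, LinearMap.comp_id]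
        rfl
    _ = tensorPairing D.pair α (D.mul b c β γ) ∘ₗ D.comul := by
        rw [tensorPairing_comp_comul, tensorPairing_comp_comul, D.mul_assoc]
    _ = (tensorFunctional (totalPairing D.pair α) (tensorPairing D.pair β γ) ∘ₗ
          TensorProduct.map LinearMap.id D.comul) ∘ₗ D.comul := by
        rw [tensorFunctional_comp_map, D.tensorPairing_comp_comul β γ, LinearMap.comp_id]
        rfl

/-- The counit: evaluation at the unit of the algebra. -/
def counit : Dual ℝ (⨁ k, U k) := totalPairing D.pair D.one

lemma lid_rTensor_counit (x : (⨁ k, U k) ⊗[ℝ] (⨁ k, U k)) (β : A b) :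
    totalPairing D.pair β (TensorProduct.lid ℝ _ (D.counit.rTensor _ x)) =
      tensorPairing D.pair D.one β x := by
  induction x with
  | zero => simp only [map_zero]
  | add x y hx hy => simp only [map_add, hx, hy]
  | tmul S T => simp [counit, tensorPairing, tensorFunctional_tmul]

lemma rid_lTensor_counit (x : (⨁ k, U k) ⊗[ℝ] (⨁ k, U k)) (α : A a) :
    totalPairing D.pair α (TensorProduct.rid ℝ _ (D.counit.lTensor _ x)) =
      tensorPairing D.pair α D.one x := by
  induction x with
  | zero => simp only [map_zero]
  | add x y hx hy => simp only [map_add, hx, hy]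
  | tmul S T => simp [counit, tensorPairing, tensorFunctional_tmul, mul_comm]

lemma rTensor_counit_comul (T : ⨁ k, U k) : D.counit.rTensor _ (D.comul T) = 1 ⊗ₜ T :=
  (TensorProduct.lid ℝ _).injective <| injective_pi_totalPairing D.pair_injective <|
    funext fun ⟨b, β⟩ => by
      simp only [LinearMap.pi_apply, lid_rTensor_counit, tensorPairing_comul, D.one_mul,
        TensorProduct.lid_tmul, one_smul]

lemma lTensor_counit_comul (T : ⨁ k, U k) : D.counit.lTensor _ (D.comul T) = T ⊗ₜ 1 :=
  (TensorProduct.rid ℝ _).injective <| injective_pi_totalPairing D.pair_injective <|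
    funext fun ⟨a, α⟩ => by
      simp only [LinearMap.pi_apply, rid_lTensor_counit, tensorPairing_comul, D.mul_one,
        TensorProduct.rid_tmul, one_smul]

/-- The coalgebra structure dual to the algebra structure. -/
abbrev coalgebra : Coalgebra ℝ (⨁ k, U k) where
  comul := D.comul
  counit := D.counit
  coassoc := D.assoc_comp_rTensor_comul_comp_comul
  rTensor_counit_comp_comul := LinearMap.ext D.rTensor_counit_comul
  lTensor_counit_comp_comul := LinearMap.ext D.lTensor_counit_comul

lemma exists_pair_eq_pair_d (T : U (k + 1)) :
    ∃ S, D.pair k S = (D.pair (k + 1)).compl₂ (D.d k) T := by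
  obtain ⟨r, hr⟩ := D.exhaustive (k + 1) T
  have hann : (D.pair (k + 1)).compl₂ (D.d k) T ∈ (D.J k (r + 1 + 1)).dualAnnihilator :=
    (Submodule.mem_dualAnnihilator _).2 fun α hα => D.mem_filtration_iff.1 hr _ (D.d_mem hα)
  rw [← D.map_pair] at hann
  exact LinearMap.map_le_range hann

/-- The boundary: the transpose of the differential. -/
def boundary (k : ℕ) : U (k + 1) →ₗ[ℝ] U k :=
  LinearMap.codRestrictOfInjective ((D.pair (k + 1)).compl₂ (D.d k)) _ (D.pair_injective k)
    D.exists_pair_eq_pair_d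

lemma pair_boundary (T : U (k + 1)) (α : A k) :
    D.pair k (D.boundary k T) α = D.pair (k + 1) T (D.d k α) :=
  LinearMap.congr_fun (LinearMap.codRestrictOfInjective_comp_apply _ _ (D.pair_injective k)
    D.exists_pair_eq_pair_d T) α

lemma boundary_mem_filtration {T : U (k + 1)} (hT : T ∈ F (k + 1) r) :
    D.boundary k T ∈ F k (r + 1) :=
  D.mem_filtration_iff.2 fun α hα => by
    rw [D.pair_boundary]
    exact D.mem_filtration_iff.1 hT _ (D.d_mem hα)

lemma boundary_boundary (T : U (k + 2)) : D.boundary k (D.boundary (k + 1) T) = 0 :=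
  D.pair_injective k <| LinearMap.ext fun α => by
    rw [D.pair_boundary, D.pair_boundary, D.d_d, map_zero, map_zero, LinearMap.zero_apply]

lemma totalPairing_comp_totalBoundary (α : A k) :
    totalPairing D.pair α ∘ₗ totalBoundary D.boundary = totalPairing D.pair (D.d k α) := by
  refine DirectSum.linearMap_ext ℝ fun l => LinearMap.ext fun T => ?_
  simp only [LinearMap.comp_apply, totalBoundary, DirectSum.toModule_lof]
  cases l with
  | zero =>
    rw [LinearMap.zero_apply, map_zero, totalPairing_lof_of_ne _ (Nat.succ_ne_zero k).symm]
  | succ l =>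
    rw [LinearMap.comp_apply]
    rcases eq_or_ne l k with rfl | h
    · rw [totalPairing_lof, totalPairing_lof, pair_boundary]
    · rw [totalPairing_lof_of_ne _ h, totalPairing_lof_of_ne _ (Nat.succ_injective.ne h)]

lemma comul_comp_totalBoundary : D.comul ∘ₗ totalBoundary D.boundary =
    (TensorProduct.map (totalBoundary D.boundary) LinearMap.id +
      TensorProduct.map (gradingSign U) (totalBoundary D.boundary)) ∘ₗ D.comul := by
  refine eq_of_forall_comp_eq (injective_pi_tensorPairing D.pair_injective)
    fun ⟨⟨a, α⟩, ⟨b, β⟩⟩ => ?_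
  have hleft : tensorPairing D.pair α β ∘ₗ
      TensorProduct.map (totalBoundary D.boundary) LinearMap.id =
        tensorPairing D.pair (D.d a α) β := by
    rw [tensorPairing, tensorFunctional_comp_map, totalPairing_comp_totalBoundary,
      LinearMap.comp_id]
    rfl
  have hright : tensorPairing D.pair α β ∘ₗ
      TensorProduct.map (gradingSign U) (totalBoundary D.boundary) =
        (-1 : ℝ) ^ a • tensorPairing D.pair α (D.d b β) := by
    rw [tensorPairing, tensorFunctional_comp_map, totalPairing_comp_totalBoundary,
      totalPairing_comp_gradingSign, tensorFunctional_smul_left]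
    rfl
  rw [← LinearMap.comp_assoc, ← LinearMap.comp_assoc, LinearMap.comp_add, hleft, hright,
    tensorPairing_comp_comul, totalPairing_comp_totalBoundary, D.leibniz, LinearMap.add_comp,
    LinearMap.smul_comp, tensorPairing_comp_comul, tensorPairing_comp_comul]

/-- The filtered differential graded coalgebra dual to a filtered differential graded algebra. -/
def filteredDGCoalgebra : FilteredDGCoalgebra U F where
  toCoalgebra := D.coalgebra
  boundary := D.boundary
  filtration_mono := D.monotone_filtration
  filtration_exhaustive := D.exhaustive
  comul_mem _ _ _ := D.comul_mem_tensorFiltration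
  counit_lof_succ k T := totalPairing_lof_of_ne _ (Nat.succ_ne_zero k) _ T
  boundary_mem _ _ _ := D.boundary_mem_filtration
  boundary_boundary _ := D.boundary_boundary
  counit_boundary T := (totalPairing_lof _ _ _).trans (by rw [D.pair_boundary, D.d_one, map_zero])
  comul_boundary := D.comul_comp_totalBoundary

end FilteredDuality

end FilteredDuality

/-! ### The algebra of smooth differential forms -/

section ChartExpressions

variable {E : Type*} [NormedAddCommGroup E] [NormedSpace ℝ E]
  {M : Type*} [TopologicalSpace M] [ChartedSpace E M] {r : WithTop ℕ∞} {k : ℕ}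

lemma contDiffAt_formInChart (α : DiffForm E M r k) {x₀ : M} {y : E}
    (hy : y ∈ (chartAt E x₀).target) : ContDiffAt ℝ r (formInChart α.1 x₀) y :=
  (α.2 x₀).contDiffAt ((chartAt E x₀).open_target.mem_nhds hy)

lemma differentiableAt_formInChart (α : DiffForm E M ∞ k) {x₀ : M} {y : E}
    (hy : y ∈ (chartAt E x₀).target) : DifferentiableAt ℝ (formInChart α.1 x₀) y :=
  (contDiffAt_formInChart α hy).differentiableAt (by simp)

lemma formInChart_comp_mfderiv_chart [IsManifold 𝓘(ℝ, E) ∞ M] (α : RawForm E M k) {x₀ x : M}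
    (hx : x ∈ (chartAt E x₀).source) :
    (formInChart α x₀ (chartAt E x₀ x)).compContinuousLinearMap
      (mfderiv 𝓘(ℝ, E) 𝓘(ℝ, E) (chartAt E x₀) x) = α x := by
  have hD := (mdifferentiable_chart (I := 𝓘(ℝ, E)) x₀).symm_comp_deriv hx
  let β : M → E [⋀^Fin k]→L[ℝ] ℝ := α
  suffices h : ((β ((chartAt E x₀).symm (chartAt E x₀ x))).compContinuousLinearMap
      (mfderiv 𝓘(ℝ, E) 𝓘(ℝ, E) (chartAt E x₀).symm (chartAt E x₀ x) : E →L[ℝ] E)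
      ).compContinuousLinearMap (mfderiv 𝓘(ℝ, E) 𝓘(ℝ, E) (chartAt E x₀) x : E →L[ℝ] E) = β x from h
  rw [(chartAt E x₀).left_inv hx]
  exact ContinuousAlternatingMap.ext fun v =>
    congrArg (β x) (funext fun i => DFunLike.congr_fun hD (v i))

lemma rawForm_ext [IsManifold 𝓘(ℝ, E) ∞ M] {α β : RawForm E M k}
    (h : ∀ x, formInChart α x (chartAt E x x) = formInChart β x (chartAt E x x)) : α = β :=
  funext fun x => by
    rw [← formInChart_comp_mfderiv_chart α (mem_chart_source E x), h,
      formInChart_comp_mfderiv_chart β (mem_chart_source E x)]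

lemma DiffForm.ext_formInChart [IsManifold 𝓘(ℝ, E) ∞ M] {α β : DiffForm E M r k}
    (h : ∀ x, ∀ y ∈ (chartAt E x).target, formInChart α.1 x y = formInChart β.1 x y) : α = β :=
  Subtype.ext (rawForm_ext fun x => h x _ (mem_chart_target E x))

lemma formInChart_d [IsManifold 𝓘(ℝ, E) ∞ M] (α : DiffForm E M ∞ k) (x₀ : M) :
    Set.EqOn (formInChart α.d.1 x₀) (extDeriv (formInChart α.1 x₀)) (chartAt E x₀).target :=
  fun _ hy => formInChart_extDerivForm α x₀ hy

lemma formInChart_wedge [FiniteDimensional ℝ E] {a b : ℕ} (α : DiffForm E M ∞ a)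
    (β : DiffForm E M ∞ b) (x₀ : M) (y : E) :
    formInChart (α.wedge β).1 x₀ y = altWedge (formInChart α.1 x₀ y) (formInChart β.1 x₀ y) :=
  altWedge_comp _ _ _

end ChartExpressions

section ExteriorDerivative

variable (E : Type*) [NormedAddCommGroup E] [NormedSpace ℝ E]

/-- The wedge product of alternating forms as a continuous bilinear map, the shape needed to
differentiate it. -/
def altWedgeL [FiniteDimensional ℝ E] (a b : ℕ) :
    (E [⋀^Fin a]→L[ℝ] ℝ) →L[ℝ] (E [⋀^Fin b]→L[ℝ] ℝ) →L[ℝ] (E [⋀^Fin (a + b)]→L[ℝ] ℝ) :=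
  haveI := finiteDimensional_alternating (E := E) a
  haveI := finiteDimensional_alternating (E := E) b
  (altWedgeₗ E a b).toContinuousBilinearMap

variable {E}

lemma altWedgeL_apply [FiniteDimensional ℝ E] {a b : ℕ} (f : E [⋀^Fin a]→L[ℝ] ℝ)
    (g : E [⋀^Fin b]→L[ℝ] ℝ) : altWedgeL E a b f g = altWedge f g := by
  have := finiteDimensional_alternating (E := E) a
  have := finiteDimensional_alternating (E := E) b
  rw [altWedgeL, LinearMap.toContinuousBilinearMap_apply]
  rfl

lemma extDeriv_altWedge_apply [FiniteDimensional ℝ E] {a b : ℕ} {f : E → E [⋀^Fin a]→L[ℝ] ℝ}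
    {g : E → E [⋀^Fin b]→L[ℝ] ℝ} {y : E} (hf : DifferentiableAt ℝ f y)
    (hg : DifferentiableAt ℝ g y) (v : Fin (a + b + 1) → E) :
    extDeriv (fun z => altWedge (f z) (g z)) y v =
      altWedge (extDeriv f y) (g y) (v ∘ finCongr (Nat.add_right_comm a 1 b)) +
        (-1) ^ a * altWedge (f y) (extDeriv g y) v := by
  have h := (altWedgeL E a b).hasFDerivAt_of_bilinear hf.hasFDerivAt hg.hasFDerivAt
  simp only [altWedgeL_apply] at h
  rw [extDeriv, h.fderiv, ContinuousAlternatingMap.alternatizeUncurryFin_add,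
    ContinuousAlternatingMap.add_apply, add_comm,
    alternatizeUncurryFin_altWedge_left (fderiv ℝ f y) (g y) _ fun x => altWedgeL_apply _ _,
    alternatizeUncurryFin_altWedge_right (f y) (fderiv ℝ g y) _ fun x => altWedgeL_apply _ _]
  rfl

end ExteriorDerivative

namespace DiffForm

variable {E : Type*} [NormedAddCommGroup E] [NormedSpace ℝ E]
  {M : Type*} [TopologicalSpace M] [ChartedSpace E M] {a b c k l : ℕ}

/-- Transport of a form along an equality of degrees. -/
def cast (h : k = l) (α : DiffForm E M ∞ k) : DiffForm E M ∞ l := h ▸ α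

lemma cast_apply (h : k = l) (α : DiffForm E M ∞ k) (x : M) (v : Fin l → TangentSpace 𝓘(ℝ, E) x) :
    (α.cast h).1 x v = α.1 x (v ∘ finCongr h) := by
  subst h; rfl

lemma formInChart_cast_apply (h : k = l) (α : DiffForm E M ∞ k) (x : M) (y : E)
    (v : Fin l → E) : formInChart (α.cast h).1 x y v = formInChart α.1 x y (v ∘ finCongr h) := by
  subst h; rfl

section D

variable [IsManifold 𝓘(ℝ, E) ∞ M]

variable (E M) in
/-- The exterior derivative of smooth forms as a linear map. -/
def dₗ (k : ℕ) : DiffForm E M ∞ k →ₗ[ℝ] DiffForm E M ∞ (k + 1) where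
  toFun := d
  map_add' α β := ext_formInChart fun x y hy => calc
    _ = extDeriv (formInChart α.1 x + formInChart β.1 x) y := formInChart_d (α + β) x hy
    _ = extDeriv (formInChart α.1 x) y + extDeriv (formInChart β.1 x) y :=
      extDeriv_add (differentiableAt_formInChart α hy) (differentiableAt_formInChart β hy)
    _ = formInChart α.d.1 x y + formInChart β.d.1 x y := by
      rw [formInChart_d α x hy, formInChart_d β x hy]
  map_smul' c α := ext_formInChart fun x y hy => calc
    _ = extDeriv (c • formInChart α.1 x) y := formInChart_d (c • α) x hy
    _ = c • extDeriv (formInChart α.1 x) y := extDeriv_smul c _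
    _ = c • formInChart α.d.1 x y := by rw [formInChart_d α x hy]

lemma d_d (α : DiffForm E M ∞ k) : α.d.d = 0 :=
  ext_formInChart fun x y hy => calc
    formInChart α.d.d.1 x y = extDeriv (formInChart α.d.1 x) y := formInChart_d α.d x hy
    _ = extDeriv (extDeriv (formInChart α.1 x)) y :=
      ((formInChart_d α x).eventuallyEq_of_mem ((chartAt E x).open_target.mem_nhds hy)).extDeriv_eq
    _ = 0 := extDeriv_extDeriv_apply (contDiffAt_formInChart α hy)
      (by simpa using WithTop.coe_le_coe.2 (le_top : (2 : ℕ∞) ≤ ⊤))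

lemma d_one : (one : DiffForm E M ∞ 0).d = 0 :=
  ext_formInChart fun x y hy => calc
    formInChart (one : DiffForm E M ∞ 0).d.1 x y =
        extDeriv (fun _ => ContinuousAlternatingMap.constOfIsEmpty ℝ E (Fin 0) (1 : ℝ)) y :=
      formInChart_d one x hy
    _ = 0 := by
      rw [extDeriv_constOfIsEmpty, fderiv_fun_const]
      exact ContinuousAlternatingMap.ext fun _ => rfl

end D

variable [FiniteDimensional ℝ E]

variable (E M) in
/-- The wedge product of smooth forms as a bilinear map. -/
def wedgeₗ (a b : ℕ) : DiffForm E M ∞ a →ₗ[ℝ] DiffForm E M ∞ b →ₗ[ℝ] DiffForm E M ∞ (a + b) :=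
  LinearMap.mk₂ ℝ wedge
    (fun α β γ => Subtype.ext <| funext fun x => (altWedgeₗ E a b).map_add₂ (α.1 x) (β.1 x) (γ.1 x))
    (fun c α β => Subtype.ext <| funext fun x => (altWedgeₗ E a b).map_smul₂ c (α.1 x) (β.1 x))
    (fun α β γ => Subtype.ext <| funext fun x => (altWedgeₗ E a b (α.1 x)).map_add (β.1 x) (γ.1 x))
    (fun c α β => Subtype.ext <| funext fun x => (altWedgeₗ E a b (α.1 x)).map_smul c (β.1 x))

lemma wedge_assoc (α : DiffForm E M ∞ a) (β : DiffForm E M ∞ b) (γ : DiffForm E M ∞ c) :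
    ((α.wedge β).wedge γ).cast (add_assoc a b c) = α.wedge (β.wedge γ) :=
  Subtype.ext <| funext fun x => ContinuousAlternatingMap.ext fun v =>
    (cast_apply _ _ x v).trans (altWedge_assoc (α.1 x) (β.1 x) (γ.1 x) v)

lemma one_wedge (β : DiffForm E M ∞ b) : (one.wedge β).cast (zero_add b) = β :=
  Subtype.ext <| funext fun x => ContinuousAlternatingMap.ext fun v =>
    (cast_apply _ _ x v).trans (one_altWedge (β.1 x) v)

lemma wedge_one (β : DiffForm E M ∞ b) : β.wedge one = β :=
  Subtype.ext <| funext fun x => ContinuousAlternatingMap.ext fun v => altWedge_one (β.1 x) v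

lemma d_wedge [IsManifold 𝓘(ℝ, E) ∞ M] (α : DiffForm E M ∞ a) (β : DiffForm E M ∞ b) :
    (α.wedge β).d = (α.d.wedge β).cast (Nat.add_right_comm a 1 b) +
      (-1 : ℝ) ^ a • (α.wedge β.d : DiffForm E M ∞ (a + b + 1)) :=
  ext_formInChart fun x y hy => ContinuousAlternatingMap.ext fun v => by
    have hwedge : formInChart (α.wedge β).1 x =
        fun z => altWedge (formInChart α.1 x z) (formInChart β.1 x z) :=
      funext (formInChart_wedge α β x)
    rw [formInChart_d (α.wedge β) x hy, hwedge, extDeriv_altWedge_apply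
      (differentiableAt_formInChart α hy) (differentiableAt_formInChart β hy),
      ← formInChart_d α x hy, ← formInChart_d β x hy, ← formInChart_wedge, ← formInChart_wedge,
      ← formInChart_cast_apply]
    rfl

end DiffForm

/-! ### Jets of forms at a point -/

section Jets

open Module (Dual)

variable {E : Type*} [NormedAddCommGroup E] [NormedSpace ℝ E]
  {M : Type*} [TopologicalSpace M] [ChartedSpace E M] {a b k n s t : ℕ} {r : WithTop ℕ∞} {p : M}

lemma continuous_iteratedFDeriv_formInChart {x₀ : M} {j : ℕ} (hj : (j : WithTop ℕ∞) ≤ r) {y : E}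
    (hy : y ∈ (chartAt E x₀).target) :
    Continuous fun α : DiffForm E M r k => iteratedFDeriv ℝ j (formInChart α.1 x₀) y := by
  have h : Continuous fun α : DiffForm E M r k =>
      UniformOnFun.ofFun {K : Set E | IsCompact K ∧ K ⊆ (chartAt E x₀).target}
        (iteratedFDeriv ℝ j (formInChart α.1 x₀)) :=
    continuous_iff_le_induced.2 (iInf_le_of_le x₀ (iInf₂_le j hj))
  exact (UniformOnFun.uniformContinuous_eval_of_mem (β := E [×j]→L[ℝ] (E [⋀^Fin k]→L[ℝ] ℝ))
    (𝔖 := {K : Set E | IsCompact K ∧ K ⊆ (chartAt E x₀).target}) (s := {y}) rfl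
    ⟨isCompact_singleton, Set.singleton_subset_iff.2 hy⟩).continuous.comp h

/-- The space of Taylor coefficients of order `< n` of `k`-forms on `E`. -/
def JetSpace (E : Type*) [NormedAddCommGroup E] [NormedSpace ℝ E] (k n : ℕ) : Type _ :=
  (i : Fin n) → E [×(i : ℕ)]→L[ℝ] (E [⋀^Fin k]→L[ℝ] ℝ)

instance (k n : ℕ) : NormedAddCommGroup (JetSpace E k n) :=
  Pi.normedAddCommGroup (G := fun i : Fin n => E [×(i : ℕ)]→L[ℝ] (E [⋀^Fin k]→L[ℝ] ℝ))

instance (k n : ℕ) : NormedSpace ℝ (JetSpace E k n) :=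
  Pi.normedSpace (E := fun i : Fin n => E [×(i : ℕ)]→L[ℝ] (E [⋀^Fin k]→L[ℝ] ℝ))

/-- The Taylor coefficients of order `< n` at `p` of a `C^r` form in the preferred chart, as a
continuous linear map. -/
def jetAt (p : M) (k n : ℕ) (hn : ∀ i < n, (i : WithTop ℕ∞) ≤ r) :
    DiffForm E M r k →L[ℝ] JetSpace E k n where
  toFun α i := iteratedFDeriv ℝ i (formInChart α.1 p) (chartAt E p p)
  map_add' α β := funext fun i => iteratedFDeriv_add_apply
    ((contDiffAt_formInChart α (mem_chart_target E p)).of_le (hn i i.2))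
    ((contDiffAt_formInChart β (mem_chart_target E p)).of_le (hn i i.2))
  map_smul' c α := funext fun i => iteratedFDeriv_const_smul_apply (a := c)
    ((contDiffAt_formInChart α (mem_chart_target E p)).of_le (hn i i.2))
  cont := continuous_pi fun i =>
    continuous_iteratedFDeriv_formInChart (hn i i.2) (mem_chart_target E p)

lemma natCast_le_infty (i : ℕ) : (i : WithTop ℕ∞) ≤ ∞ :=
  ENat.natCast_le_of_coe_top_le_withTop le_rfl i

variable (E) in
/-- The smooth forms whose Taylor coefficients of order `< s` at `p` vanish. -/
def vanishingForms (p : M) (k s : ℕ) : Submodule ℝ (DiffForm E M ∞ k) :=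
  LinearMap.ker (jetAt p k s fun i _ => natCast_le_infty i).toLinearMap

lemma mem_vanishingForms {α : DiffForm E M ∞ k} : α ∈ vanishingForms E p k s ↔
    ∀ i < s, iteratedFDeriv ℝ i (formInChart α.1 p) (chartAt E p p) = 0 :=
  funext_iff.trans Fin.forall_iff

lemma vanishingForms_zero (p : M) (k : ℕ) : vanishingForms E p k 0 = ⊤ :=
  Submodule.eq_top_iff'.2 fun _ => mem_vanishingForms.2 fun i hi => absurd hi i.not_lt_zero

lemma vanishingForms_antitone (p : M) (k : ℕ) : Antitone (vanishingForms E p k) :=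
  fun _ _ hst _ h => mem_vanishingForms.2 fun i hi => mem_vanishingForms.1 h i (hi.trans_le hst)

lemma mem_vanishingForms_of_eventually_eq_zero {α : DiffForm E M ∞ k}
    (h : ∀ᶠ x in 𝓝 p, α.1 x = 0) (s : ℕ) : α ∈ vanishingForms E p k s := by
  refine mem_vanishingForms.2 fun i _ => ?_
  have hcoord : formInChart α.1 p =ᶠ[𝓝 (chartAt E p p)] 0 := by
    have hc := (chartAt E p).continuousAt_symm (mem_chart_target E p)
    rw [ContinuousAt, (chartAt E p).left_inv (mem_chart_source E p)] at hc
    filter_upwards [hc.eventually h] with y hy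
    simp only [formInChart, hy]
    rfl
  rw [(hcoord.iteratedFDeriv ℝ i).eq_of_nhds, iteratedFDeriv_zero, Pi.zero_apply]

lemma d_mem_vanishingForms [IsManifold 𝓘(ℝ, E) ∞ M] {α : DiffForm E M ∞ k}
    (h : α ∈ vanishingForms E p k (s + 1)) : α.d ∈ vanishingForms E p (k + 1) s := by
  refine mem_vanishingForms.2 fun i hi => ?_
  have hp := mem_chart_target E p
  have hd := (formInChart_d α p).eventuallyEq_of_mem ((chartAt E p).open_target.mem_nhds hp)
  have hsmooth : ContDiffAt ℝ i (fderiv ℝ (formInChart α.1 p)) (chartAt E p p) :=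
    (contDiffAt_formInChart α hp).fderiv_right (natCast_le_infty (i + 1))
  have hzero : iteratedFDeriv ℝ i (fderiv ℝ (formInChart α.1 p)) (chartAt E p p) = 0 := by
    rw [← norm_eq_zero, norm_iteratedFDeriv_fderiv,
      mem_vanishingForms.1 h (i + 1) (Nat.succ_lt_succ hi), norm_zero]
  rw [(hd.iteratedFDeriv ℝ i).eq_of_nhds]
  refine ((ContinuousAlternatingMap.alternatizeUncurryFinCLM (n := k) ℝ E ℝ
    ).iteratedFDeriv_comp_left hsmooth le_rfl).trans ?_
  rw [hzero]
  exact ContinuousMultilinearMap.ext fun _ =>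
    map_zero (ContinuousAlternatingMap.alternatizeUncurryFinCLM (n := k) ℝ E ℝ)

section FiniteDimensional

variable [FiniteDimensional ℝ E]

lemma finiteDimensional_continuousMultilinearMap (n : ℕ) (G : Type*) [NormedAddCommGroup G]
    [NormedSpace ℝ G] [FiniteDimensional ℝ G] : FiniteDimensional ℝ (E [×n]→L[ℝ] G) :=
  FiniteDimensional.of_injective
    (ContinuousMultilinearMap.toMultilinearMapLinear :
      (E [×n]→L[ℝ] G) →ₗ[ℝ] MultilinearMap ℝ (fun _ : Fin n => E) G)
    ContinuousMultilinearMap.toMultilinearMap_injective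

instance finiteDimensional_jetSpace (k n : ℕ) : FiniteDimensional ℝ (JetSpace E k n) := by
  have := finiteDimensional_alternating (E := E) k
  have (i : Fin n) : FiniteDimensional ℝ (E [×(i : ℕ)]→L[ℝ] (E [⋀^Fin k]→L[ℝ] ℝ)) :=
    finiteDimensional_continuousMultilinearMap _ _
  exact Module.Finite.pi (M := fun i : Fin n => E [×(i : ℕ)]→L[ℝ] (E [⋀^Fin k]→L[ℝ] ℝ))

lemma finiteDimensional_quotient_vanishingForms (p : M) (k s : ℕ) :
    FiniteDimensional ℝ (DiffForm E M ∞ k ⧸ vanishingForms E p k s) :=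
  Module.Finite.equiv (LinearMap.quotKerEquivRange _).symm

lemma wedge_mem_vanishingForms {α : DiffForm E M ∞ a} {β : DiffForm E M ∞ b}
    (hα : α ∈ vanishingForms E p a s) (hβ : β ∈ vanishingForms E p b t) :
    α.wedge β ∈ vanishingForms E p (a + b) (s + t) := by
  refine mem_vanishingForms.2 fun n hn => norm_le_zero_iff.1 ?_
  have hp := mem_chart_target E p
  have hopen := (chartAt E p).open_target
  have hwedge : formInChart (α.wedge β).1 p =
      fun y => altWedgeL E a b (formInChart α.1 p y) (formInChart β.1 p y) :=
    funext fun y => by rw [altWedgeL_apply, formInChart_wedge]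
  have hleibniz := (altWedgeL E a b).norm_iteratedFDerivWithin_le_of_bilinear (α.2 p) (β.2 p)
    hopen.uniqueDiffOn hp (natCast_le_infty n)
  simp only [iteratedFDerivWithin_of_isOpen _ hopen hp, ← hwedge] at hleibniz
  refine hleibniz.trans_eq ?_
  rw [Finset.sum_eq_zero, mul_zero]
  intro i hi
  have hin := Finset.mem_range_succ_iff.1 hi
  rcases lt_or_ge i s with his | his
  · rw [mem_vanishingForms.1 hα i his, norm_zero, mul_zero, zero_mul]
  · rw [mem_vanishingForms.1 hβ (n - i) (by omega), norm_zero, mul_zero]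

lemma exists_comp_jetAt_eq {f : Dual ℝ (DiffForm E M ∞ k)}
    (hf : f ∈ (vanishingForms E p k n).dualAnnihilator) :
    ∃ g : JetSpace E k n →L[ℝ] ℝ, ∀ α, g (jetAt p k n (fun i _ => natCast_le_infty i) α) = f α := by
  rw [vanishingForms, ← LinearMap.range_dualMap_eq_dualAnnihilator_ker] at hf
  obtain ⟨g, rfl⟩ := hf
  exact ⟨LinearMap.toContinuousLinearMap g, fun α => rfl⟩

end FiniteDimensional

variable (E) in
/-- Evaluation of currents of dimension `k` at `p` on smooth `k`-forms. -/
def currentPairing (p : M) (k : ℕ) : atomicCurrents E p k →ₗ[ℝ] Dual ℝ (DiffForm E M ∞ k) where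
  toFun T := T.1.toLinearMap
  map_add' _ _ := rfl
  map_smul' _ _ := rfl

lemma currentPairing_injective (p : M) (k : ℕ) : Function.Injective (currentPairing E p k) :=
  fun _ _ h => Subtype.ext (ContinuousLinearMap.ext fun α => LinearMap.congr_fun h α)

lemma dualAnnihilator_vanishingForms_le [FiniteDimensional ℝ E] (p : M) (k m : ℕ) :
    (vanishingForms E p k (m + 1)).dualAnnihilator ≤
      (orderFiltration E p k m).map (currentPairing E p k) := by
  intro f hf
  obtain ⟨g, hg⟩ := exists_comp_jetAt_eq hf
  have horder : ∀ i < m + 1, (i : WithTop ℕ∞) ≤ m := fun i hi => by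
    exact_mod_cast Nat.lt_succ_iff.1 hi
  refine ⟨⟨g.comp (jetAt p k (m + 1) fun i _ => natCast_le_infty i), fun α hα => ?_⟩,
    ⟨g.comp (jetAt p k (m + 1) horder), fun α => rfl⟩, LinearMap.ext hg⟩
  exact (hg α).trans ((Submodule.mem_dualAnnihilator f).1 hf α
    (mem_vanishingForms_of_eventually_eq_zero hα _))

end Jets

/-! ### Cutoffs of functions with vanishing jets -/

section Cutoff

variable {E : Type*} [NormedAddCommGroup E] [NormedSpace ℝ E]
  {G : Type*} [NormedAddCommGroup G] [NormedSpace ℝ G]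
  {β : E → G} {χ : E → ℝ} {O : Set E} {y y₀ : E} {R C K ε : ℝ} {n r i : ℕ}

lemma norm_iteratedFDeriv_le_mul_pow_of_vanishing_jet
    (hβ : ∀ y ∈ Metric.closedBall y₀ R, ContDiffAt ℝ n β y)
    (hjet : ∀ b < n, iteratedFDeriv ℝ b β y₀ = 0)
    (hK : ∀ y ∈ Metric.closedBall y₀ R, ‖iteratedFDeriv ℝ n β y‖ ≤ K) {b m : ℕ} (hbm : b + m = n)
    (hy : y ∈ Metric.closedBall y₀ R) : ‖iteratedFDeriv ℝ b β y‖ ≤ K * ‖y - y₀‖ ^ m := by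
  have hK₀ : 0 ≤ K := (norm_nonneg _).trans (hK y hy)
  induction m generalizing b y with
  | zero =>
    obtain rfl : b = n := hbm
    simpa only [pow_zero, mul_one] using hK y hy
  | succ m ih =>
    have hsub : Metric.closedBall y₀ ‖y - y₀‖ ⊆ Metric.closedBall y₀ R :=
      Metric.closedBall_subset_closedBall (by rwa [← dist_eq_norm, ← Metric.mem_closedBall])
    have hderiv : ∀ z ∈ Metric.closedBall y₀ ‖y - y₀‖,
        ‖fderiv ℝ (iteratedFDeriv ℝ b β) z‖ ≤ K * ‖y - y₀‖ ^ m := fun z hz => by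
      rw [norm_fderiv_iteratedFDeriv]
      refine (ih (by omega) (hsub hz)).trans ?_
      gcongr
      rwa [← dist_eq_norm, ← Metric.mem_closedBall]
    have hmean := (convex_closedBall y₀ ‖y - y₀‖).norm_image_sub_le_of_norm_fderiv_le
      (fun z hz => (hβ z (hsub hz)).differentiableAt_iteratedFDeriv
        (by exact_mod_cast (by omega : b < n)))
      hderiv (Metric.mem_closedBall_self (norm_nonneg _))
      (Metric.mem_closedBall.2 (dist_eq_norm y y₀).le)
    rwa [hjet b (by omega), sub_zero, mul_assoc, ← pow_succ] at hmean

lemma norm_iteratedFDeriv_smul_le_of_scaling (hO : IsOpen O) (hy : y ∈ O) (hε : 0 < ε)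
    (hin : i ≤ n) (hχ : ContDiffOn ℝ i χ O) (hβ : ContDiffOn ℝ i β O)
    (hC : ∀ a ≤ i, ‖iteratedFDeriv ℝ a χ y‖ ≤ C * ε⁻¹ ^ a)
    (hK : ∀ b ≤ i, ‖iteratedFDeriv ℝ b β y‖ ≤ K * ε ^ (n - b)) :
    ‖iteratedFDeriv ℝ i (fun z => χ z • β z) y‖ ≤ 2 ^ i * (C * K * ε ^ (n - i)) := by
  have hleibniz := norm_iteratedFDerivWithin_smul_le hχ hβ hO.uniqueDiffOn hy le_rfl
  simp only [iteratedFDerivWithin_of_isOpen _ hO hy] at hleibniz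
  have hterm : ∀ a ∈ Finset.range (i + 1),
      (i.choose a : ℝ) * ‖iteratedFDeriv ℝ a χ y‖ * ‖iteratedFDeriv ℝ (i - a) β y‖ ≤
        (i.choose a : ℝ) * (C * K * ε ^ (n - i)) := fun a ha => by
    have hai := Finset.mem_range_succ_iff.1 ha
    have hpow : n - (i - a) = a + (n - i) := by omega
    calc (i.choose a : ℝ) * ‖iteratedFDeriv ℝ a χ y‖ * ‖iteratedFDeriv ℝ (i - a) β y‖
        ≤ (i.choose a : ℝ) * (C * ε⁻¹ ^ a) * (K * ε ^ (n - (i - a))) := by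
          have := (norm_nonneg _).trans (hC a hai)
          gcongr
          exacts [hC a hai, hK _ (Nat.sub_le i a)]
      _ = (i.choose a : ℝ) * (C * K * ε ^ (n - i)) := by
          rw [hpow, pow_add, inv_pow]
          field_simp
  calc ‖iteratedFDeriv ℝ i (fun z => χ z • β z) y‖
      ≤ ∑ a ∈ Finset.range (i + 1), (i.choose a : ℝ) * (C * K * ε ^ (n - i)) :=
        hleibniz.trans (Finset.sum_le_sum hterm)
    _ = 2 ^ i * (C * K * ε ^ (n - i)) := by
        rw [← Finset.sum_mul]
        exact_mod_cast congrArg (fun N : ℕ => (N : ℝ) * (C * K * ε ^ (n - i)))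
          (Nat.sum_range_choose i)

variable [FiniteDimensional ℝ E]

lemma exists_bound_iteratedFDeriv_contDiffBump {c : E} (χ : ContDiffBump c) (r : ℕ) :
    ∃ C, ∀ a ≤ r, ∀ y, ‖iteratedFDeriv ℝ a χ y‖ ≤ C := by
  have hbound (a : ℕ) : ∃ C, ∀ y, ‖iteratedFDeriv ℝ a χ y‖ ≤ C :=
    (χ.contDiff.continuous_iteratedFDeriv le_rfl).bounded_above_of_compact_support
      (χ.hasCompactSupport.iteratedFDeriv a)
  choose C hC using hbound
  exact ⟨∑ a ∈ Finset.range (r + 1), C a, fun a ha y => (hC a y).trans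
    (Finset.single_le_sum (fun a _ => (norm_nonneg _).trans (hC a y))
      (Finset.mem_range_succ_iff.2 ha))⟩

lemma exists_scaled_cutoffs (y₀ : E) (r : ℕ) : ∃ C, ∀ ε > 0, ∃ χ : E → ℝ, ContDiff ℝ ∞ χ ∧
    (∀ᶠ y in 𝓝 y₀, χ y = 1) ∧ (∀ y, ε ≤ dist y y₀ → χ y = 0) ∧
      ∀ a ≤ r, ∀ y, ‖iteratedFDeriv ℝ a χ y‖ ≤ C * ε⁻¹ ^ a := by
  let χ₁ : ContDiffBump (0 : E) := ⟨1 / 2, 1, one_half_pos, one_half_lt_one⟩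
  obtain ⟨C, hC⟩ := exists_bound_iteratedFDeriv_contDiffBump χ₁ r
  refine ⟨C, fun ε hε => ⟨fun y => χ₁ (ε⁻¹ • (y - y₀)),
    χ₁.contDiff.comp ((contDiff_id.sub contDiff_const).const_smul _), ?_, ?_, ?_⟩⟩
  · have hcont : ContinuousAt (fun y => ε⁻¹ • (y - y₀)) y₀ := by fun_prop
    have hone : ∀ᶠ z in 𝓝 (ε⁻¹ • (y₀ - y₀)), χ₁ z = 1 := by
      rw [sub_self, smul_zero]
      exact χ₁.eventuallyEq_one
    exact hcont.eventually hone
  · intro y hy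
    refine χ₁.zero_of_le_dist ?_
    rw [dist_zero_right, norm_smul, norm_inv, Real.norm_of_nonneg hε.le, ← dist_eq_norm,
      inv_mul_eq_div]
    exact (one_le_div hε).2 hy
  · intro a ha y
    have hscale : iteratedFDeriv ℝ a (fun y => χ₁ (ε⁻¹ • (y - y₀))) y =
        ε⁻¹ ^ a • iteratedFDeriv ℝ a χ₁ (ε⁻¹ • (y - y₀)) := by
      rw [iteratedFDeriv_comp_sub (f := fun z => χ₁ (ε⁻¹ • z)),
        iteratedFDeriv_comp_const_smul ε⁻¹ χ₁.contDiff]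
    rw [hscale, norm_smul, Real.norm_of_nonneg (by positivity), mul_comm]
    gcongr
    exact hC a ha _

lemma exists_cutoff_norm_iteratedFDeriv_smul_le (hO : IsOpen O) (hy₀ : y₀ ∈ O)
    (hβ : ContDiffOn ℝ ∞ β O) (hjet : ∀ i ≤ r, iteratedFDeriv ℝ i β y₀ = 0) (hR : 0 < R) {δ : ℝ}
    (hδ : 0 < δ) : ∃ χ : E → ℝ, ContDiff ℝ ∞ χ ∧ (∀ᶠ y in 𝓝 y₀, χ y = 1) ∧
      (∀ y, R ≤ dist y y₀ → χ y = 0) ∧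
      ∀ i ≤ r, ∀ y ∈ O, ‖iteratedFDeriv ℝ i (fun z => χ z • β z) y‖ ≤ δ := by
  obtain ⟨R₀, hR₀, hball⟩ := Metric.nhds_basis_closedBall.mem_iff.1 (hO.mem_nhds hy₀)
  have hβat : ∀ y ∈ O, ContDiffAt ℝ (r + 1 : ℕ) β y := fun y hy =>
    (hβ.contDiffAt (hO.mem_nhds hy)).of_le (natCast_le_infty _)
  obtain ⟨K, hK⟩ := (isCompact_closedBall y₀ R₀).exists_bound_of_continuousOn fun y hy =>
    ((hβat y (hball hy)).continuousAt_iteratedFDeriv le_rfl).continuousWithinAt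
  obtain ⟨C, hC⟩ := exists_scaled_cutoffs y₀ r
  have hsmall : ∀ᶠ ε in 𝓝[>] (0 : ℝ), ε ≤ 1 ∧ ε ≤ R ∧ ε ≤ R₀ ∧ 2 ^ r * (|C| * |K| * ε) ≤ δ := by
    have hlim : Filter.Tendsto (fun ε : ℝ => 2 ^ r * (|C| * |K| * ε)) (𝓝 0) (𝓝 0) :=
      Continuous.tendsto' (by fun_prop) _ _ (by simp)
    exact nhdsWithin_le_nhds ((eventually_le_nhds one_pos).and ((eventually_le_nhds hR).and
      ((eventually_le_nhds hR₀).and (hlim.eventually (eventually_le_nhds hδ)))))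
  obtain ⟨ε, ⟨hε1, hεR, hεR₀, hεδ⟩, hε : 0 < ε⟩ := (hsmall.and self_mem_nhdsWithin).exists
  obtain ⟨χ, hχ, hχone, hχzero, hχC⟩ := hC ε hε
  refine ⟨χ, hχ, hχone, fun y hy => hχzero y (hεR.trans hy), fun i hi y hy => ?_⟩
  rcases lt_or_ge ε (dist y y₀) with hfar | hnear
  · have hzero : (fun z => χ z • β z) =ᶠ[𝓝 y] 0 := by
      have hopen : IsOpen {z | ε < dist z y₀} := isOpen_lt (by fun_prop) (by fun_prop)
      filter_upwards [hopen.mem_nhds hfar] with z hz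
      rw [hχzero z (le_of_lt hz), zero_smul, Pi.zero_apply]
    rw [(hzero.iteratedFDeriv ℝ i).eq_of_nhds, iteratedFDeriv_zero, Pi.zero_apply, norm_zero]
    exact hδ.le
  · have htaylor : ∀ b ≤ i, ‖iteratedFDeriv ℝ b β y‖ ≤ |K| * ε ^ (r + 1 - b) := fun b hb => by
      refine (norm_iteratedFDeriv_le_mul_pow_of_vanishing_jet (fun z hz => hβat z (hball hz))
        (fun b hb => hjet b (Nat.lt_succ_iff.1 hb)) hK (Nat.add_sub_cancel' (by omega))
        (Metric.mem_closedBall.2 (hnear.trans hεR₀))).trans ?_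
      rw [← dist_eq_norm]
      gcongr
      exact le_abs_self K
    have hcut : ∀ a ≤ i, ‖iteratedFDeriv ℝ a χ y‖ ≤ |C| * ε⁻¹ ^ a := fun a ha =>
      (hχC a (ha.trans hi) y).trans (by gcongr; exact le_abs_self C)
    calc ‖iteratedFDeriv ℝ i (fun z => χ z • β z) y‖
        ≤ 2 ^ i * (|C| * |K| * ε ^ (r + 1 - i)) :=
          norm_iteratedFDeriv_smul_le_of_scaling hO hy hε (by omega)
            (hχ.of_le (natCast_le_infty i)).contDiffOn (hβ.of_le (natCast_le_infty i)) hcut htaylor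
      _ ≤ 2 ^ r * (|C| * |K| * ε) := by
          gcongr
          exacts [one_le_two, pow_le_of_le_one hε.le hε1 (by omega)]
      _ ≤ δ := hεδ

end Cutoff

/-! ### Change of charts -/

section ChangeOfCharts

section Bounds

variable {E F G H : Type*} [NormedAddCommGroup E] [NormedSpace ℝ E]
  [NormedAddCommGroup F] [NormedSpace ℝ F] [NormedAddCommGroup G] [NormedSpace ℝ G]
  [NormedAddCommGroup H] [NormedSpace ℝ H] {n : ℕ}

lemma exists_eventually_norm_iteratedFDeriv_le {f : E → F} {y : E} (hf : ContDiffAt ℝ n f y) :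
    ∃ C : ℝ, 1 ≤ C ∧ ∀ᶠ z in 𝓝 y, ∀ i ≤ n, ‖iteratedFDeriv ℝ i f z‖ ≤ C := by
  have hbound (i : ℕ) (hi : i ≤ n) : ∃ C, ∀ᶠ z in 𝓝 y, ‖iteratedFDeriv ℝ i f z‖ ≤ C :=
    ⟨_, (hf.continuousAt_iteratedFDeriv (by exact_mod_cast hi)).norm.eventually_le_const
      (lt_add_one _)⟩
  choose! C hC using hbound
  obtain ⟨B, hB⟩ := ((Finset.range (n + 1)).image C).exists_le
  refine ⟨max 1 B, le_max_left 1 B, ?_⟩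
  have hall : ∀ᶠ z in 𝓝 y, ∀ i ∈ Finset.range (n + 1), ‖iteratedFDeriv ℝ i f z‖ ≤ C i :=
    (Filter.eventually_all_finset _).2 fun i hi => hC i (Finset.mem_range_succ_iff.1 hi)
  filter_upwards [hall] with z hz i hi
  have hi' := Finset.mem_range_succ_iff.2 hi
  exact (hz i hi').trans ((hB _ (Finset.mem_image_of_mem C hi')).trans (le_max_right 1 B))

lemma exists_eventually_norm_iteratedFDeriv_clm_apply_comp_le {O : Set E} {t : Set F}
    (hO : IsOpen O) (ht : IsOpen t) {τ : E → F} {L : E → G →L[ℝ] H} (hτ : ContDiffOn ℝ n τ O)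
    (hL : ContDiffOn ℝ n L O) (hmap : Set.MapsTo τ O t) {y : E} (hy : y ∈ O) :
    ∃ C : ℝ, 0 ≤ C ∧ ∀ᶠ z in 𝓝 y, ∀ (β : F → G) (δ : ℝ), ContDiffOn ℝ n β t →
      (∀ i ≤ n, ‖iteratedFDeriv ℝ i β (τ z)‖ ≤ δ) →
      ‖iteratedFDeriv ℝ n (fun w => L w (β (τ w))) z‖ ≤ C * δ := by
  obtain ⟨D, hD, hDτ⟩ := exists_eventually_norm_iteratedFDeriv_le (hτ.contDiffAt (hO.mem_nhds hy))
  obtain ⟨D', hD', hDL⟩ := exists_eventually_norm_iteratedFDeriv_le (hL.contDiffAt (hO.mem_nhds hy))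
  refine ⟨∑ i ∈ Finset.range (n + 1), (n.choose i : ℝ) * D' * ((n - i).factorial * D ^ (n - i)),
    Finset.sum_nonneg fun i _ => by positivity, ?_⟩
  filter_upwards [hDτ, hDL, hO.mem_nhds hy] with z hzτ hzL hzO β δ hβ hδ
  have hleibniz := norm_iteratedFDerivWithin_clm_apply hL (hβ.comp hτ hmap) hO.uniqueDiffOn hzO
    le_rfl
  rw [iteratedFDerivWithin_of_isOpen n hO hzO] at hleibniz
  refine hleibniz.trans ?_
  rw [Finset.sum_mul]
  refine Finset.sum_le_sum fun i hi => ?_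
  have hin := Finset.mem_range_succ_iff.1 hi
  have hcomp : ‖iteratedFDerivWithin ℝ (n - i) (β ∘ τ) O z‖ ≤
      (n - i).factorial * δ * D ^ (n - i) := by
    refine norm_iteratedFDerivWithin_comp_le hβ hτ (by exact_mod_cast Nat.sub_le n i)
      ht.uniqueDiffOn hO.uniqueDiffOn hmap hzO (fun j hj => ?_) fun j hj1 hj => ?_
    · rw [iteratedFDerivWithin_of_isOpen j ht (hmap hzO)]
      exact hδ j (by omega)
    · rw [iteratedFDerivWithin_of_isOpen j hO hzO]
      exact (hzτ j (by omega)).trans (le_self_pow₀ hD (by omega))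
  rw [iteratedFDerivWithin_of_isOpen i hO hzO]
  calc (n.choose i : ℝ) * ‖iteratedFDeriv ℝ i L z‖ * ‖iteratedFDerivWithin ℝ (n - i) (β ∘ τ) O z‖
      ≤ (n.choose i : ℝ) * D' * ((n - i).factorial * δ * D ^ (n - i)) := by
        gcongr
        exact hzL i hin
    _ = _ := by ring

lemma contDiffOn_compContinuousLinearMapCLM [FiniteDimensional ℝ E] [FiniteDimensional ℝ F] {k : ℕ}
    {r : WithTop ℕ∞} {O : Set G} {A : G → E →L[ℝ] F} (hA : ContDiffOn ℝ r A O) :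
    ContDiffOn ℝ r (fun z => (ContinuousAlternatingMap.compContinuousLinearMapCLM (A z) :
      (F [⋀^Fin k]→L[ℝ] ℝ) →L[ℝ] (E [⋀^Fin k]→L[ℝ] ℝ))) O := by
  have := finiteDimensional_alternating (E := F) k
  have := finiteDimensional_continuousMultilinearMap (E := E) k ℝ
  refine contDiffOn_clm_apply.2 fun η => ?_
  let incl : (E [⋀^Fin k]→L[ℝ] ℝ) →L[ℝ] (E [×k]→L[ℝ] ℝ) :=
    ContinuousAlternatingMap.toContinuousMultilinearMapCLM ℝ
  obtain ⟨g, hg⟩ := incl.toLinearMap.exists_leftInverse_of_injective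
    (LinearMap.ker_eq_bot.2 ContinuousAlternatingMap.toContinuousMultilinearMap_injective)
  have hmultilinear : ContDiffOn ℝ r
      (fun z => ContinuousMultilinearMap.compContinuousLinearMapContinuousMultilinear ℝ
        (fun _ : Fin k => E) (fun _ : Fin k => F) ℝ (fun _ => A z)
          η.toContinuousMultilinearMap) O :=
    ((ContinuousMultilinearMap.contDiff _).comp_contDiffOn
      (contDiffOn_pi.2 fun _ => hA)).clm_apply contDiffOn_const
  refine ((LinearMap.toContinuousLinearMap g).contDiff.comp_contDiffOn hmultilinear).congr
    fun z _ => ?_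
  exact (LinearMap.congr_fun hg (η.compContinuousLinearMap (A z))).symm

end Bounds

variable {E : Type*} [NormedAddCommGroup E] [NormedSpace ℝ E]
  {M : Type*} [TopologicalSpace M] [ChartedSpace E M]

variable (E) in
/-- The transition map from the preferred chart around `x₀` to the one around `x₁`. -/
abbrev chartTransition (x₀ x₁ : M) : OpenPartialHomeomorph E E :=
  (chartAt E x₀).symm.trans (chartAt E x₁)

variable [IsManifold 𝓘(ℝ, E) ∞ M]

lemma contDiffOn_chartTransition (x₀ x₁ : M) :
    ContDiffOn ℝ ∞ (chartTransition E x₀ x₁) (chartTransition E x₀ x₁).source :=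
  contMDiffOn_iff_contDiffOn.1 ((contMDiffOn_chart (I := 𝓘(ℝ, E)) (n := ∞) (x := x₁)).comp
    ((contMDiffOn_chart_symm (I := 𝓘(ℝ, E)) (n := ∞) (x := x₀)).mono Set.inter_subset_left)
    Set.inter_subset_right)

lemma formInChart_eq_pullback_chartTransition {k : ℕ} (α : RawForm E M k) {x₀ x₁ : M} {z : E}
    (hz : z ∈ (chartTransition E x₀ x₁).source) :
    formInChart α x₀ z = ContinuousAlternatingMap.compContinuousLinearMapCLM
      (fderiv ℝ (chartTransition E x₀ x₁) z) (formInChart α x₁ (chartTransition E x₀ x₁ z)) := by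
  obtain ⟨hz₀ : z ∈ (chartAt E x₀).target,
    hz₁ : (chartAt E x₀).symm z ∈ (chartAt E x₁).source⟩ := hz
  have hchain : fderiv ℝ (chartTransition E x₀ x₁) z =
      (mfderiv 𝓘(ℝ, E) 𝓘(ℝ, E) (chartAt E x₁) ((chartAt E x₀).symm z)).comp
        (mfderiv 𝓘(ℝ, E) 𝓘(ℝ, E) (chartAt E x₀).symm z) :=
    mfderiv_eq_fderiv.symm.trans (mfderiv_comp z
      (mdifferentiableAt_atlas (I := 𝓘(ℝ, E)) (chart_mem_atlas E x₁) hz₁)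
      (mdifferentiableAt_atlas_symm (I := 𝓘(ℝ, E)) (chart_mem_atlas E x₀) hz₀))
  rw [hchain, formInChart, ← formInChart_comp_mfderiv_chart α hz₁]
  rfl

end ChangeOfCharts

/-! ### Small forms and the order of a current -/

section Localization

variable {E : Type*} [NormedAddCommGroup E] [NormedSpace ℝ E]
  {M : Type*} [TopologicalSpace M] [ChartedSpace E M]

/-- The `C^r` forms which vanish outside `Q` and whose derivatives of order at most `n` in the
preferred chart around `p` are bounded by `δ`. For `Q` a compact subset of the chart domain these
sets, with `n ≤ r` and `0 < δ`, are a neighbourhood basis of `0` in the space of forms which vanish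
outside `Q`. -/
def smallForms (p : M) (Q : Set M) (r : WithTop ℕ∞) (k n : ℕ) (δ : ℝ) : Set (DiffForm E M r k) :=
  {α | (∀ x ∉ Q, α.1 x = 0) ∧
    ∀ i ≤ n, ∀ y ∈ (chartAt E p).target, ‖iteratedFDeriv ℝ i (formInChart α.1 p) y‖ ≤ δ}

lemma smallForms_mono {p : M} {Q : Set M} {r : WithTop ℕ∞} {k m n : ℕ} {δ ε : ℝ} (hmn : m ≤ n)
    (hδε : δ ≤ ε) : (smallForms p Q r k n δ : Set (DiffForm E M r k)) ⊆ smallForms p Q r k m ε :=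
  fun _ hα => ⟨hα.1, fun i hi y hy => (hα.2 i (hi.trans hmn) y hy).trans hδε⟩

lemma DiffForm.le_nhds_zero {r : WithTop ℕ∞} {k : ℕ} {l : Filter (DiffForm E M r k)}
    (hl : ∀ (x₀ : M) (j : ℕ), (j : WithTop ℕ∞) ≤ r → ∀ y ∈ (chartAt E x₀).target, ∀ ε > 0,
      ∃ t ∈ 𝓝 y, ∀ᶠ α in l, ∀ z ∈ t, ‖iteratedFDeriv ℝ j (formInChart α.1 x₀) z‖ < ε) :
    l ≤ 𝓝 0 := by
  simp only [nhds_iInf, le_iInf_iff, nhds_induced, ← Filter.map_le_iff_le_comap]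
  intro x₀ j hj
  refine UniformOnFun.tendsto_iff_tendstoUniformlyOn.2 fun K hK => ?_
  rw [← tendstoLocallyUniformlyOn_iff_tendstoUniformlyOn_of_compact hK.1,
    Metric.tendstoLocallyUniformlyOn_iff]
  intro ε hε y hy
  obtain ⟨t, ht, hsmall⟩ := hl x₀ j hj y (hK.2 hy) ε hε
  refine ⟨t, mem_nhdsWithin_of_mem_nhds ht, hsmall.mono fun α hα z hz => ?_⟩
  have hzero : iteratedFDeriv ℝ j (formInChart (0 : DiffForm E M r k).1 x₀) z = 0 :=
    congrFun (iteratedFDeriv_zero (𝕜 := ℝ) (E := E) (F := E [⋀^Fin k]→L[ℝ] ℝ)) z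
  change dist (iteratedFDeriv ℝ j (formInChart (0 : DiffForm E M r k).1 x₀) z)
    (iteratedFDeriv ℝ j (formInChart α.1 x₀) z) < ε
  rw [hzero, dist_zero_left]
  exact hα z hz

lemma exists_nhds_iteratedFDeriv_formInChart_eq_zero {Q : Set M} (hQ : IsClosed Q) {x₀ : M} {y : E}
    (hy : y ∈ (chartAt E x₀).target) (hyQ : (chartAt E x₀).symm y ∉ Q) :
    ∃ t ∈ 𝓝 y, ∀ (k j : ℕ) (α : RawForm E M k), (∀ x ∉ Q, α x = 0) →
      ∀ z ∈ t, iteratedFDeriv ℝ j (formInChart α x₀) z = 0 := by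
  have hopen := (chartAt E x₀).isOpen_inter_preimage_symm hQ.isOpen_compl
  refine ⟨_, hopen.mem_nhds ⟨hy, hyQ⟩, fun k j α hα z hz => ?_⟩
  have hzero : formInChart α x₀ =ᶠ[𝓝 z] 0 := by
    filter_upwards [hopen.mem_nhds hz] with w hw
    rw [formInChart, hα _ hw.2]
    rfl
  rw [(hzero.iteratedFDeriv ℝ j).eq_of_nhds, iteratedFDeriv_zero, Pi.zero_apply]

lemma atomicCurrent_congr {p : M} {k : ℕ} (T : atomicCurrents E p k) {α β : DiffForm E M ∞ k}
    (h : ∀ᶠ x in 𝓝 p, α.1 x = β.1 x) : T.1 α = T.1 β := by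
  rw [← sub_eq_zero, ← map_sub]
  exact T.2 _ (h.mono fun _ => sub_eq_zero_of_eq)

variable [IsManifold 𝓘(ℝ, E) ∞ M]

/-- The product of a smooth form with a smooth function. -/
def DiffForm.funSMul (ρ : M → ℝ) (hρ : ContMDiff 𝓘(ℝ, E) 𝓘(ℝ, ℝ) ∞ ρ) {k : ℕ}
    (α : DiffForm E M ∞ k) : DiffForm E M ∞ k :=
  ⟨fun x => ρ x • α.1 x, fun x₀ => (contMDiffOn_iff_contDiffOn.1 (hρ.comp_contMDiffOn
    (contMDiffOn_chart_symm (I := 𝓘(ℝ, E)) (n := ∞) (x := x₀)))).smul (α.2 x₀)⟩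

variable [FiniteDimensional ℝ E]

lemma exists_nhds_norm_iteratedFDeriv_lt_of_mem_smallForms {p x₀ : M} {y : E}
    (hy : y ∈ (chartTransition E x₀ p).source) (k j : ℕ) {ε : ℝ} (hε : 0 < ε) :
    ∃ t ∈ 𝓝 y, ∃ δ > 0, ∀ (Q : Set M) (r : WithTop ℕ∞), (j : WithTop ℕ∞) ≤ r →
      ∀ α ∈ (smallForms p Q r k j δ : Set (DiffForm E M r k)), ∀ z ∈ t,
        ‖iteratedFDeriv ℝ j (formInChart α.1 x₀) z‖ < ε := by
  let τ := chartTransition E x₀ p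
  have hτ : ContDiffOn ℝ ∞ τ τ.source := contDiffOn_chartTransition x₀ p
  have hpullback : ContDiffOn ℝ ∞ (fun z => (ContinuousAlternatingMap.compContinuousLinearMapCLM
      (fderiv ℝ τ z) : (E [⋀^Fin k]→L[ℝ] ℝ) →L[ℝ] (E [⋀^Fin k]→L[ℝ] ℝ))) τ.source :=
    contDiffOn_compContinuousLinearMapCLM (hτ.fderiv_of_isOpen τ.open_source (by simp))
  have hmap : Set.MapsTo τ τ.source (chartAt E p).target :=
    fun z hz => (chartAt E p).map_source hz.2
  obtain ⟨C, hC, hbound⟩ := exists_eventually_norm_iteratedFDeriv_clm_apply_comp_le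
    τ.open_source (chartAt E p).open_target (hτ.of_le (natCast_le_infty j))
    (hpullback.of_le (natCast_le_infty j)) hmap hy
  refine ⟨_, Filter.inter_mem hbound (τ.open_source.mem_nhds hy), ε / (C + 1), by positivity,
    fun Q r hjr α hα z ⟨hz, hzτ⟩ => ?_⟩
  have hchange : formInChart α.1 x₀ =ᶠ[𝓝 z] fun w =>
      ContinuousAlternatingMap.compContinuousLinearMapCLM (fderiv ℝ τ w)
        (formInChart α.1 p (τ w)) := by
    filter_upwards [τ.open_source.mem_nhds hzτ] with w hw
    exact formInChart_eq_pullback_chartTransition α.1 hw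
  rw [(hchange.iteratedFDeriv ℝ j).eq_of_nhds]
  calc _ ≤ C * (ε / (C + 1)) :=
        hz _ _ ((α.2 p).of_le hjr) fun i hi => hα.2 i hi _ (hmap hzτ)
    _ < ε := by
        rw [mul_div_assoc', div_lt_iff₀ (by positivity)]
        nlinarith

lemma exists_smallForms_subset [T2Space M] {p : M} {Q : Set M} (hQ : IsCompact Q)
    (hQp : Q ⊆ (chartAt E p).source) {r : WithTop ℕ∞} {k : ℕ} {U : Set (DiffForm E M r k)}
    (hU : U ∈ 𝓝 0) :
    ∃ n : ℕ, (n : WithTop ℕ∞) ≤ r ∧ ∃ δ > 0, smallForms p Q r k n δ ⊆ U := by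
  let s : Set (ℕ × ℝ) := {x | (x.1 : WithTop ℕ∞) ≤ r ∧ 0 < x.2}
  let l : Filter (DiffForm E M r k) :=
    ⨅ x ∈ s, Filter.principal (smallForms p Q r k x.1 x.2)
  have hbasis : l.HasBasis s fun x => smallForms p Q r k x.1 x.2 := by
    refine Filter.hasBasis_biInf_principal' (fun x hx y hy => ⟨(max x.1 y.1, min x.2 y.2),
      ⟨?_, lt_min hx.2 hy.2⟩, smallForms_mono (le_max_left _ _) (min_le_left _ _),
      smallForms_mono (le_max_right _ _) (min_le_right _ _)⟩) ⟨(0, 1), by simp, one_pos⟩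
    rcases max_choice x.1 y.1 with h | h <;> simp only [h, hx.1, hy.1]
  have hl : l ≤ 𝓝 0 := DiffForm.le_nhds_zero fun x₀ j hj y hy ε hε => by
    by_cases hyQ : (chartAt E x₀).symm y ∈ Q
    · obtain ⟨t, ht, δ, hδ, hsmall⟩ :=
        exists_nhds_norm_iteratedFDeriv_lt_of_mem_smallForms (p := p) ⟨hy, hQp hyQ⟩ k j hε
      exact ⟨t, ht, Filter.mem_of_superset (hbasis.mem_of_mem (i := (j, δ)) ⟨hj, hδ⟩)
        (hsmall Q r hj)⟩
    · obtain ⟨t, ht, hzero⟩ := exists_nhds_iteratedFDeriv_formInChart_eq_zero hQ.isClosed hy hyQ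
      refine ⟨t, ht, Filter.mem_of_superset (hbasis.mem_of_mem (i := (0, 1)) ⟨by simp, one_pos⟩)
        fun α hα z hz => ?_⟩
      rw [hzero k j α.1 hα.1 z hz, norm_zero]
      exact hε
  obtain ⟨⟨n, δ⟩, ⟨hn, hδ⟩, hnU⟩ := hbasis.mem_iff.1 (hl hU)
  exact ⟨n, hn, δ, hδ, hnU⟩

lemma exists_mem_smallForms_eventuallyEq [T2Space M] {p : M} (f : SmoothBumpFunction 𝓘(ℝ, E) p)
    {k n : ℕ} {α : DiffForm E M ∞ k} (hα : α ∈ vanishingForms E p k (n + 1)) {δ : ℝ} (hδ : 0 < δ) :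
    ∃ γ ∈ smallForms p (tsupport f) ∞ k n δ, ∀ᶠ x in 𝓝 p, γ.1 x = α.1 x := by
  obtain ⟨χ, hχ, hχ_one, hχ_zero, hsmall⟩ := exists_cutoff_norm_iteratedFDeriv_smul_le
    (chartAt E p).open_target (mem_chart_target E p) (α.2 p) (r := n)
    (fun i hi => mem_vanishingForms.1 hα i (Nat.lt_succ_iff.2 hi)) f.rIn_pos hδ
  have hρ : ContMDiff 𝓘(ℝ, E) 𝓘(ℝ, ℝ) ∞ fun x => f x • χ (chartAt E p x) :=
    f.contMDiff_smul (hχ.contMDiff.comp_contMDiffOn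
      (contMDiffOn_chart (I := 𝓘(ℝ, E)) (n := ∞) (x := p)))
  have hfχ {z : E} (hz : z ∈ (chartAt E p).target) : f ((chartAt E p).symm z) • χ z = χ z := by
    rcases le_or_gt f.rIn (dist z (chartAt E p p)) with hd | hd
    · rw [hχ_zero z hd, smul_zero]
    · rw [f.one_of_dist_le ((chartAt E p).map_target hz)
        (by simpa [(chartAt E p).right_inv hz] using hd.le), one_smul]
  refine ⟨α.funSMul _ hρ, ⟨fun x hx => ?_, fun i hi y hy => ?_⟩, ?_⟩
  · change (f x • χ (chartAt E p x)) • α.1 x = 0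
    rw [image_eq_zero_of_notMem_tsupport hx, zero_smul, zero_smul]
  · have hchart : formInChart (α.funSMul _ hρ).1 p =ᶠ[𝓝 y] fun z => χ z • formInChart α.1 p z := by
      filter_upwards [(chartAt E p).open_target.mem_nhds hy] with z hz
      change (f ((chartAt E p).symm z) • χ (chartAt E p ((chartAt E p).symm z))) •
        formInChart α.1 p z = χ z • formInChart α.1 p z
      rw [(chartAt E p).right_inv hz, hfχ hz]
    rw [(hchart.iteratedFDeriv ℝ i).eq_of_nhds]
    exact hsmall i hi y hy
  · have hχ_chart := ((chartAt E p).continuousAt (mem_chart_source E p)).eventually hχ_one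
    filter_upwards [f.eventuallyEq_one, hχ_chart] with x hfx hχx
    change (f x • χ (chartAt E p x)) • α.1 x = α.1 x
    rw [hfx, hχx, Pi.one_apply, one_smul, one_smul]

lemma apply_eq_zero_of_abs_lt_one_on_smallForms [T2Space M] {p : M}
    (f : SmoothBumpFunction 𝓘(ℝ, E) p) {k n : ℕ} {δ : ℝ} (hδ : 0 < δ) {T : atomicCurrents E p k}
    (hT : ∀ γ ∈ smallForms p (tsupport f) ∞ k n δ, |T.1 γ| < 1) {α : DiffForm E M ∞ k}
    (hα : α ∈ vanishingForms E p k (n + 1)) : T.1 α = 0 := by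
  by_contra hTα
  obtain ⟨γ, hγ, hγα⟩ := exists_mem_smallForms_eventuallyEq f
    (Submodule.smul_mem _ (T.1 α)⁻¹ hα) hδ
  have hTγ : T.1 γ = 1 := by
    rw [atomicCurrent_congr T hγα, map_smul, smul_eq_mul, inv_mul_cancel₀ hTα]
  simpa [hTγ] using hT γ hγ

/-- A functional continuous for the `C^r` topology is bounded by `1` on small forms, and these
approximate, near `p`, all multiples of the forms with vanishing jet. -/
lemma map_currentPairing_orderFiltration [T2Space M] (p : M) (k r : ℕ) :
    (orderFiltration E p k r).map (currentPairing E p k) =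
      (vanishingForms E p k (r + 1)).dualAnnihilator := by
  refine le_antisymm ?_ (dualAnnihilator_vanishingForms_le p k r)
  rintro _ ⟨T, ⟨S, hS⟩, rfl⟩
  rw [Submodule.mem_dualAnnihilator]
  intro α hα
  obtain ⟨f⟩ : Nonempty (SmoothBumpFunction 𝓘(ℝ, E) p) := inferInstance
  have hU : {β | |S β| < 1} ∈ 𝓝 0 :=
    (isOpen_lt S.continuous.abs continuous_const).mem_nhds (by simp)
  obtain ⟨n, hn, δ, hδ, hsmall⟩ :=
    exists_smallForms_subset f.hasCompactSupport f.tsupport_subset_chartAt_source hU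
  refine apply_eq_zero_of_abs_lt_one_on_smallForms f hδ (fun γ hγ => ?_)
    (vanishingForms_antitone p k (Nat.succ_le_succ (by exact_mod_cast hn)) hα)
  rw [← hS]
  exact hsmall hγ

lemma exists_mem_orderFiltration [T2Space M] {p : M} {k : ℕ} (T : atomicCurrents E p k) :
    ∃ r, T ∈ orderFiltration E p k r := by
  obtain ⟨f⟩ : Nonempty (SmoothBumpFunction 𝓘(ℝ, E) p) := inferInstance
  have hU : {α | |T.1 α| < 1} ∈ 𝓝 0 :=
    (isOpen_lt T.1.continuous.abs continuous_const).mem_nhds (by simp)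
  obtain ⟨n, -, δ, hδ, hsmall⟩ :=
    exists_smallForms_subset f.hasCompactSupport f.tsupport_subset_chartAt_source hU
  have hT : currentPairing E p k T ∈ (vanishingForms E p k (n + 1)).dualAnnihilator :=
    (Submodule.mem_dualAnnihilator _).2 fun _ =>
      apply_eq_zero_of_abs_lt_one_on_smallForms f hδ hsmall
  rw [← map_currentPairing_orderFiltration] at hT
  obtain ⟨S, hS, hST⟩ := hT
  exact ⟨n, currentPairing_injective p k hST ▸ hS⟩

end Localization

/-! ### The coalgebra of currents supported at a point -/

section CurrentCoalgebra

variable {E : Type*} [NormedAddCommGroup E] [NormedSpace ℝ E]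
  {M : Type*} [TopologicalSpace M] [ChartedSpace E M]

lemma evalForm_cast (p : M) {k l : ℕ} (h : k = l) (α : DiffForm E M ∞ k) :
    evalForm p (α.cast h) = evalForm p α := by
  subst h; rfl

lemma evalForm_add (p : M) {k : ℕ} (α β : DiffForm E M ∞ k) :
    evalForm p (α + β) = evalForm p α + evalForm p β :=
  LinearMap.ext fun T => map_add (DirectSum.component ℝ ℕ (fun k => atomicCurrents E p k) k T).1 α β

lemma evalForm_smul (p : M) {k : ℕ} (c : ℝ) (α : DiffForm E M ∞ k) :
    evalForm p (c • α) = c • evalForm p α :=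
  LinearMap.ext fun T =>
    map_smul (DirectSum.component ℝ ℕ (fun k => atomicCurrents E p k) k T).1 c α

variable [FiniteDimensional ℝ E] [T2Space M] [IsManifold 𝓘(ℝ, E) ∞ M]

variable (E) in
/-- The duality between smooth forms, filtered by the order of vanishing at `p`, and currents
supported at `p`, filtered by their order. -/
def currentDuality (p : M) : FilteredDuality (fun k => DiffForm E M ∞ k)
    (fun k => atomicCurrents E p k) (fun k r => orderFiltration E p k r) where
  pair := currentPairing E p
  one := DiffForm.one
  mul := DiffForm.wedgeₗ E M
  d := DiffForm.dₗ E M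
  J := vanishingForms E p
  J_zero := vanishingForms_zero p
  J_antitone := vanishingForms_antitone p
  J_finite := finiteDimensional_quotient_vanishingForms p
  mul_mem := wedge_mem_vanishingForms
  d_mem := d_mem_vanishingForms
  pair_injective := currentPairing_injective p
  map_pair := map_currentPairing_orderFiltration p
  exhaustive _ := exists_mem_orderFiltration
  mul_assoc α β γ := (evalForm_cast p _ _).symm.trans
    (congrArg (evalForm p) (DiffForm.wedge_assoc α β γ))
  one_mul β := (evalForm_cast p _ _).symm.trans (congrArg (evalForm p) (DiffForm.one_wedge β))
  mul_one β := congrArg (evalForm p) (DiffForm.wedge_one β)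
  leibniz {a b} α β := by
    change evalForm p (α.wedge β).d =
      evalForm p (α.d.wedge β) + (-1 : ℝ) ^ a • evalForm p (α.wedge β.d)
    rw [DiffForm.d_wedge, evalForm_add, evalForm_smul, evalForm_cast]
  d_d := DiffForm.d_d
  d_one := DiffForm.d_one

end CurrentCoalgebra

end

theorem mainTheorem1 {E : Type*} [NormedAddCommGroup E] [NormedSpace ℝ E] [FiniteDimensional ℝ E]
    {M : Type*} [TopologicalSpace M] [T2Space M] [ChartedSpace E M] [IsManifold 𝓘(ℝ, E) ∞ M]
    (p : M) :
    ∃ C : FilteredDGCoalgebra (fun k => atomicCurrents E p k) (fun k r => orderFiltration E p k r),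
      (∀ (a b : ℕ) (α : DiffForm E M ∞ a) (β : DiffForm E M ∞ b) (T : ⨁ k, atomicCurrents E p k),
        evalTensor p α β (C.comul T) = evalForm p (α.wedge β) T) ∧
      (∀ T : ⨁ k, atomicCurrents E p k, C.counit T = evalForm p DiffForm.one T) ∧
      (∀ (k : ℕ) (T : atomicCurrents E p (k + 1)) (α : DiffForm E M ∞ k),
        (C.boundary k T).1 α = T.1 α.d) :=
  ⟨(currentDuality E p).filteredDGCoalgebra,
    fun _ _ α β T => (currentDuality E p).tensorPairing_comul α β T,
    fun _ => rfl,
    fun _ T α => (currentDuality E p).pair_boundary T α⟩
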